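/- Let $A=(A_1,A_2,A_3)$ and $B_i=(B_{i,1},B_{i,2},B_{i,3})$, $i=1,2,3$, be four independent random vectors, each with the Dirichlet$(1/2,1/2,1/2)$ distribution, and let $$\Upsilon=\min\{A_i B_{i,j} : 1\le i\le 3,\ 1\le j\le 3\}.$$ For $\lambda>1$ put $$g(\lambda)=\frac{9\lambda}{2(\lambda-1)^{3/2}}\Big(\sqrt{\pi}+\frac{\sqrt{\pi}\,\log(\lambda-1)}{2}+\frac49\Big).$$ (a) For every real $\lambda\ge 1+e^{-2}$, $(1-\Upsilon)^{\lambda}$ is integrable and $\mathbf{E}\big[(1-\Upsilon)^{\lambda}\big]<g(\lambda)$. (b) Let $\lambda=10^6$, $\kappa=(9g(\lambda))^{-1/\lambda}$, $\tau=720$ and $\delta=1-4\times10^{-8}$. Then $\kappa>0$, $3e\log\tau<2\sqrt{\tau}$, $$\delta>\max\Big\{1-\frac{\log\kappa}{2\log\tau},\ \frac{\log 8}{2\log\tau}\Big\},\qquad\text{and}\qquad 9\,\kappa^{\lambda}\,\mathbf{E}\big[(1-\Upsilon)^{\lambda}\big]<1.$$ (c) Let $(\mathrm{RAN}_t)_{t\ge0}$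 be the random Apollonian network process: $\mathrm{RAN}_0$ is a triangle embedded in the plane and, in each step, a bounded face is chosen uniformly at random, conditionally on the choices made before, a new vertex is added inside this face, and it is joined to the three vertices of the face (so that the face is replaced by three new bounded faces). Then, almost surely, there is $N$ such that for all $t\ge N$ every (simple) path in $\mathrm{RAN}_t$ has fewer than $t^{\,1-4\times10^{-8}}$ vertices. -/

import Mathlib

open MeasureTheory ProbabilityTheory Filter
open scoped ENNReal

noncomputable section

namespace Apollonian

/-! ### The Dirichlet distribution -/

/-- The point of the hyperplane `x₀ + ⋯ + xₙ = 1` whose first `n` coordinates are `x`. -/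
def simplexPoint {n : ℕ} (x : Fin n → ℝ) : Fin (n + 1) → ℝ :=
  Fin.snoc (α := fun _ => ℝ) x (1 - ∑ i, x i)

/-- The density of the Dirichlet distribution with parameters `α`, with respect to the Lebesgue
measure in the first `n` coordinates of the simplex. -/
def dirichletPDF {n : ℕ} (α : Fin (n + 1) → ℝ) (x : Fin n → ℝ) : ℝ≥0∞ :=
  open scoped Classical in
  if (∀ i, 0 < x i) ∧ ∑ i, x i < 1 then
    ENNReal.ofReal (Real.Gamma (∑ j, α j) / (∏ j, Real.Gamma (α j)) *
      ∏ j, simplexPoint x j ^ (α j - 1))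
  else 0

/-- The Dirichlet distribution with (positive) parameters `α`, as a measure on `ℝⁿ⁺¹` carried by
the simplex. -/
def dirichletMeasure {n : ℕ} (α : Fin (n + 1) → ℝ) : Measure (Fin (n + 1) → ℝ) :=
  ((volume : Measure (Fin n → ℝ)).withDensity (dirichletPDF α)).map simplexPoint

/-- The random variable `Υ = min {A_i B_{i,j}}`, where `A = v 0` and the three coordinates
`B_{i,1}, B_{i,2}, B_{i,3}` of `v (i + 1)` split the `i`-th part `A_i`. -/
def upsilon (v : Fin 4 → Fin 3 → ℝ) : ℝ :=
  Finset.univ.inf' Finset.univ_nonempty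
    (fun p : Fin 3 × Fin 3 => v 0 p.1 * v p.1.succ p.2)

/-- `D` consists of four independent random vectors, each Dirichlet(1/2, 1/2, 1/2). -/
structure IsDirichletQuadruple {Ω : Type*} [MeasurableSpace Ω] (P : Measure Ω)
    (D : Fin 4 → Ω → Fin 3 → ℝ) : Prop where
  indep : iIndepFun D P
  law : ∀ k, HasLaw (D k) (dirichletMeasure (n := 2) fun _ => 1 / 2) P

/-- `g(λ) = 9 λ / (2 (λ - 1)^{3/2}) · (√π + √π log (λ - 1) / 2 + 4 / 9)`. -/
def g (lam : ℝ) : ℝ :=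
  9 * lam / (2 * (lam - 1) ^ (3 / 2 : ℝ)) *
    (√Real.pi + √Real.pi * Real.log (lam - 1) / 2 + 4 / 9)

/-! ### Random Apollonian networks -/

/-- An Apollonian network: a plane triangulation with vertices `0, …, order - 1`, given by its
graph and by its bounded faces. Every bounded face is a triangle and is recorded as the set of its
three vertices (distinct bounded faces have distinct vertex sets). -/
structure Network where
  order : ℕ
  graph : SimpleGraph ℕ
  faces : Finset (Finset ℕ)

/-- A single triangle with vertices `0, 1, 2`; it has one bounded face. -/
def Network.triangle : Network where
  order := 3
  graph := SimpleGraph.fromRel fun x y => x < 3 ∧ y < 3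
  faces := {{0, 1, 2}}

/-- Subdividing the bounded face `f`: a new vertex is added inside `f` and joined to the vertices
of `f`; the face `f` is replaced by three faces, each consisting of the new vertex and two of the
three vertices of `f`. -/
def Network.subdivide (N : Network) (f : Finset ℕ) : Network where
  order := N.order + 1
  graph := N.graph ⊔ SimpleGraph.fromRel fun x y => x = N.order ∧ y ∈ f
  faces := N.faces.erase f ∪ f.image fun x => insert N.order (f.erase x)

/-- The network after `t` steps, when the face subdivided in step `i + 1` is `F i`. -/
def network (F : ℕ → Finset ℕ) : ℕ → Network
  | 0 => Network.triangle
  | t + 1 => (network F t).subdivide (F t)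

/-- The graph of a network, on its vertex set `{0, …, order - 1}`. -/
def Network.toGraph (N : Network) : SimpleGraph (Fin N.order) :=
  N.graph.comap Fin.val

/-- `F t` is the (random) face subdivided in step `t + 1` of a random Apollonian network process:
conditionally on the faces chosen before, it is uniformly distributed among the bounded faces of
the network that these choices have produced. -/
structure IsUniformSubdivision {Ω : Type*} [MeasurableSpace Ω] (P : Measure Ω)
    (F : ℕ → Ω → Finset ℕ) : Prop where
  measurable : ∀ t f, MeasurableSet {ω | F t ω = f}
  uniform : ∀ (t : ℕ) (h : ℕ → Finset ℕ), ∀ f ∈ (network h t).faces,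
    P {ω | (∀ i < t, F i ω = h i) ∧ F t ω = f} =
      P {ω | ∀ i < t, F i ω = h i} / ((network h t).faces.card : ℝ≥0∞)

/-- The random Apollonian network `RAN_t`, as a graph on `t + 3` vertices. -/
def RAN {Ω : Type*} (F : ℕ → Ω → Finset ℕ) (t : ℕ) (ω : Ω) :
    SimpleGraph (Fin (network (fun i => F i ω) t).order) :=
  (network (fun i => F i ω) t).toGraph

end Apollonian

end

/-! The almost sure bound on paths is proved by a recursion on random ternary trees. It rests
neither on the moment bound for Υ nor on the explicit constants κ, τ, which are treated separately
at the end.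

A history of subdivisions is a ternary tree whose leaves are the faces, and choosing a uniform face
means expanding a uniform leaf. When all three subtriangles have been subdivided, the nine triangles
at depth two are separated by at most seven vertices: three corners, the first centre and three
second centres. A path passes through each of them at most once, so it meets the interior of at most
eight of the nine triangles (`LTree.exists_disjoint_lab`). Hence the number of inner vertices on any
path is dominated by a function X of the tree that is subadditive up to constants and drops one of
nine subtrees (`LTree.card_inter_lab_le`, `Tree.dropping_pathBound`).

`Tree.Dropping.mean_le` shows E X ≤ 10⁸ (2n+1)^(1-η) with η = 5·10⁻⁸. The dropped subtree may depend
on X, so its X-value could be unusually small. To prevent this, X is replaced by the majorant r/2 +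
X²/(2r), where r is the conjectured rate. This majorant is always at least r/2, and its mean is
almost r once E X² ≤ (1+ε) r². First and second moments are therefore bounded in one induction. The
relative second moment stays bounded because the expected sum of squared leaf fractions of the three
subtrees is at most 3/5. The gain from dropping is at least a fixed fraction of r, because the
dropped subtree's leaf fraction is bounded below by a multiple of the product of all nine leaf
fractions, and the mean of that product is bounded below.

Markov's inequality and Borel–Cantelli along the times 2^j then give the almost sure bound.
Monotonicity of the networks in time fills the gaps.

For the moment bound, Υ is one of nine products AB and 1 - u ≤ exp(-u), so the expectation is at
most nine times a bound for E exp(-λAB). Here A and B are independent Beta(1/2, 1) variables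
(`lintegral_dirichletHalf_apply`). The Laplace transform of A at λb is at most min(1, k b^(-1/2)),
and integrating over b gives k(1 - log k). What remains is the elementary inequality
`scale_bound_lt_g`. -/

noncomputable section

namespace Apollonian

/-! ### Random ternary trees -/

/-- A ternary tree: the history of subdivisions of a triangle, up to labels. -/
inductive Tree where
  | leaf : Tree
  | node : (Fin 3 → Tree) → Tree

namespace Tree

/-- The number of internal nodes. -/
def size : Tree → ℕ
  | leaf => 0
  | node t => 1 + ∑ i, (t i).size

/-- The number of leaves, as a real number. -/
def leaves (T : Tree) : ℝ := 2 * T.size + 1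

/-- The sum of `φ` over all trees that arise from `T` by expanding one leaf. -/
def grow : Tree → (Tree → ℝ) → ℝ
  | leaf, φ => φ (node fun _ => leaf)
  | node t, φ => ∑ i, (t i).grow fun s => φ (node (Function.update t i s))

lemma leaves_node (t : Fin 3 → Tree) : (node t).leaves = ∑ i, (t i).leaves := by
  simp [leaves, size, Fin.sum_univ_three]; ring

lemma one_le_leaves (T : Tree) : 1 ≤ T.leaves := by
  simp [leaves]

lemma size_update_of_size_eq (t : Fin 3 → Tree) (i : Fin 3) {s : Tree}
    (h : s.size = (t i).size + 1) :
    (node (Function.update t i s)).size = (node t).size + 1 := by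
  have h1 := Finset.sum_update_of_mem (Finset.mem_univ i) (fun j => (t j).size) s.size
  have h2 : ∀ j, (Function.update t i s j).size =
      Function.update (fun j => (t j).size) i s.size j := by
    intro j
    rcases eq_or_ne j i with rfl | hj
    · simp
    · simp [hj]
  have h3 := Finset.sum_erase_add Finset.univ (fun j => (t j).size) (Finset.mem_univ i)
  rw [Finset.sdiff_singleton_eq_erase] at h1
  simp only [size, h2, h1]
  omega

lemma grow_mono (T : Tree) {φ ψ : Tree → ℝ}
    (h : ∀ S : Tree, S.size = T.size + 1 → φ S ≤ ψ S) : T.grow φ ≤ T.grow ψ := by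
  induction T generalizing φ ψ with
  | leaf => exact h _ (by simp [size])
  | node t ih =>
    exact Finset.sum_le_sum fun i _ => ih i fun S hS =>
      h _ (size_update_of_size_eq t i hS)

lemma grow_congr (T : Tree) {φ ψ : Tree → ℝ}
    (h : ∀ S : Tree, S.size = T.size + 1 → φ S = ψ S) : T.grow φ = T.grow ψ :=
  le_antisymm (grow_mono T fun S hS => (h S hS).le) (grow_mono T fun S hS => (h S hS).ge)

lemma grow_add (T : Tree) (φ ψ : Tree → ℝ) :
    T.grow (fun S => φ S + ψ S) = T.grow φ + T.grow ψ := by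
  induction T generalizing φ ψ with
  | leaf => rfl
  | node t ih => simp only [grow, ih, Finset.sum_add_distrib]

lemma grow_const_mul (T : Tree) (c : ℝ) (φ : Tree → ℝ) :
    T.grow (fun S => c * φ S) = c * T.grow φ := by
  induction T generalizing φ with
  | leaf => rfl
  | node t ih => simp only [grow, ih, Finset.mul_sum]

lemma grow_one (T : Tree) : T.grow (fun _ => 1) = T.leaves := by
  induction T with
  | leaf => simp [grow, leaves, size]
  | node t ih => simp only [grow, ih, leaves_node]

lemma grow_const (T : Tree) (c : ℝ) : T.grow (fun _ => c) = T.leaves * c := by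
  have := grow_const_mul T c fun _ => 1
  simp only [mul_one, grow_one] at this
  rw [this, mul_comm]

/-- A function of the size is multiplied by the number of leaves. -/
lemma grow_size (T : Tree) (u : ℕ → ℝ) :
    T.grow (fun S => u S.size) = T.leaves * u (T.size + 1) := by
  rw [← grow_const]
  exact grow_congr T fun S hS => by rw [hS]

/-- The product of functions of the three subtrees. -/
def prodNode (f : Fin 3 → Tree → ℝ) : Tree → ℝ
  | leaf => 0
  | node t => ∏ i, f i (t i)

lemma prod_update_apply (f : Fin 3 → Tree → ℝ) (t : Fin 3 → Tree) (i : Fin 3) (s : Tree) :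
    ∏ j, f j (Function.update t i s j) =
      (∏ j ∈ Finset.univ.erase i, f j (t j)) * f i s := by
  rw [← Finset.mul_prod_erase _ _ (Finset.mem_univ i), mul_comm]
  congr 1
  · exact Finset.prod_congr rfl fun j hj => by simp [Finset.ne_of_mem_erase hj]
  · simp

/-- A Leibniz rule: an expansion takes place in exactly one of the three subtrees, so `grow` acts as
a derivation on products. This replaces an explicit description of the joint law of the subtree
sizes. -/
lemma grow_prodNode (f : Fin 3 → Tree → ℝ) (t : Fin 3 → Tree) :
    (node t).grow (prodNode f) =
      ∑ i, prodNode (Function.update f i fun s => s.grow (f i)) (node t) := by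
  simp only [grow, prodNode]
  refine Finset.sum_congr rfl fun i _ => ?_
  simp only [prod_update_apply, grow_const_mul]
  rw [← Finset.mul_prod_erase _ _ (Finset.mem_univ i), mul_comm]
  congr 1
  · simp
  · exact Finset.prod_congr rfl fun j hj => by simp [Finset.ne_of_mem_erase hj]

/-- The sum of `φ` over the histories of `n` successive leaf expansions. -/
def total : ℕ → (Tree → ℝ) → ℝ
  | 0, φ => φ leaf
  | n + 1, φ => total n fun T => T.grow φ

lemma total_mono (n : ℕ) {φ ψ : Tree → ℝ} (h : ∀ S : Tree, S.size = n → φ S ≤ ψ S) :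
    total n φ ≤ total n ψ := by
  induction n generalizing φ ψ with
  | zero => exact h _ rfl
  | succ n ih => exact ih fun S hS => grow_mono S fun R hR => h R (by rw [hR, hS])

lemma total_congr (n : ℕ) {φ ψ : Tree → ℝ} (h : ∀ S : Tree, S.size = n → φ S = ψ S) :
    total n φ = total n ψ :=
  le_antisymm (total_mono n fun S hS => (h S hS).le) (total_mono n fun S hS => (h S hS).ge)

lemma total_add (n : ℕ) (φ ψ : Tree → ℝ) :
    total n (fun S => φ S + ψ S) = total n φ + total n ψ := by
  induction n generalizing φ ψ with
  | zero => rfl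
  | succ n ih => simp only [total, grow_add, ih]

lemma total_const_mul (n : ℕ) (c : ℝ) (φ : Tree → ℝ) :
    total n (fun S => c * φ S) = c * total n φ := by
  induction n generalizing φ with
  | zero => rfl
  | succ n ih => simp only [total, grow_const_mul, ih]

lemma total_zero (n : ℕ) : total n (fun _ => 0) = 0 := by
  simpa using total_const_mul n 0 fun _ => 0

lemma total_nonneg (n : ℕ) {φ : Tree → ℝ} (h : ∀ S, 0 ≤ φ S) : 0 ≤ total n φ :=
  (total_zero n).symm.le.trans (total_mono n fun S _ => h S)

lemma total_sum {ι : Type*} (n : ℕ) (s : Finset ι) (φ : ι → Tree → ℝ) :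
    total n (fun S => ∑ i ∈ s, φ i S) = ∑ i ∈ s, total n (φ i) := by
  classical
  induction s using Finset.induction_on with
  | empty => simpa using total_zero n
  | insert a s ha ih => simp only [Finset.sum_insert ha, total_add, ih]

/-- The number of histories of length `n`. -/
def histories (n : ℕ) : ℝ := ∏ i ∈ Finset.range n, (2 * (i : ℝ) + 1)

lemma histories_pos (n : ℕ) : 0 < histories n := Finset.prod_pos fun i _ => by positivity

lemma histories_succ (n : ℕ) : histories (n + 1) = histories n * (2 * n + 1) :=
  Finset.prod_range_succ _ n

lemma total_size (n : ℕ) (u : ℕ → ℝ) : total n (fun S => u S.size) = histories n * u n := by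
  induction n generalizing u with
  | zero => simp [total, size, histories]
  | succ n ih =>
    simp only [total, grow_size]
    have := ih fun k => (2 * k + 1) * u (k + 1)
    simp only [leaves] at *
    rw [this, histories_succ]; ring

lemma total_succ_congr {n : ℕ} {φ ψ : Tree → ℝ} (h : ∀ t, φ (node t) = ψ (node t)) :
    total (n + 1) φ = total (n + 1) ψ :=
  total_congr _ fun S hS => by
    cases S with
    | leaf => simp [size] at hS
    | node t => exact h t

lemma total_prodNode_succ (n : ℕ) (f : Fin 3 → Tree → ℝ) :
    total (n + 2) (prodNode f) =
      ∑ i, total (n + 1) (prodNode (Function.update f i fun s => s.grow (f i))) := by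
  rw [← total_sum]
  exact total_succ_congr (φ := fun T => T.grow (prodNode f)) fun t => grow_prodNode f t

/-- Conditionally on their sizes, the three subtrees are independent and distributed like the
tree itself; here in the form of a comparison of products. -/
lemma total_prodNode_le (n : ℕ) {f g : Fin 3 → Tree → ℝ}
    (h0 : ∀ i, ∀ m ≤ n, 0 ≤ total m (f i)) (h : ∀ i, ∀ m ≤ n, total m (f i) ≤ total m (g i)) :
    total (n + 1) (prodNode f) ≤ total (n + 1) (prodNode g) := by
  induction n generalizing f g with
  | zero =>
    exact Finset.prod_le_prod (s := Finset.univ) (f := fun i => f i leaf)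
      (g := fun i => g i leaf) (fun i _ => h0 i 0 le_rfl) fun i _ => h i 0 le_rfl
  | succ n ih =>
    -- One step is moved into a factor. Its hypothesis at m then becomes the original one at m + 1,
    -- which is why the hypotheses range over all m ≤ n.
    rw [total_prodNode_succ, total_prodNode_succ]
    refine Finset.sum_le_sum fun i _ => ih (fun j m hm => ?_) fun j m hm => ?_
    all_goals
      rcases eq_or_ne j i with rfl | hj
      · simp only [Function.update_self]
        first
          | exact h0 j (m + 1) (by omega)
          | exact h j (m + 1) (by omega)
      · simp only [Function.update_of_ne hj]
        first
          | exact h0 j m (by omega)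
          | exact h j m (by omega)

/-- The expectation of `φ` after `n` uniformly random leaf expansions. -/
def mean (n : ℕ) (φ : Tree → ℝ) : ℝ := total n φ / histories n

lemma mean_mono (n : ℕ) {φ ψ : Tree → ℝ} (h : ∀ S : Tree, S.size = n → φ S ≤ ψ S) :
    mean n φ ≤ mean n ψ :=
  div_le_div_of_nonneg_right (total_mono n h) (histories_pos n).le

lemma mean_congr (n : ℕ) {φ ψ : Tree → ℝ} (h : ∀ S : Tree, S.size = n → φ S = ψ S) :
    mean n φ = mean n ψ := by
  rw [mean, total_congr n h, mean]

lemma mean_add (n : ℕ) (φ ψ : Tree → ℝ) :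
    mean n (fun S => φ S + ψ S) = mean n φ + mean n ψ := by
  simp only [mean, total_add, add_div]

lemma mean_const_mul (n : ℕ) (c : ℝ) (φ : Tree → ℝ) :
    mean n (fun S => c * φ S) = c * mean n φ := by
  simp only [mean, total_const_mul, mul_div_assoc]

lemma mean_sum {ι : Type*} (n : ℕ) (s : Finset ι) (φ : ι → Tree → ℝ) :
    mean n (fun S => ∑ i ∈ s, φ i S) = ∑ i ∈ s, mean n (φ i) := by
  simp only [mean, total_sum, Finset.sum_div]

lemma mean_size (n : ℕ) (u : ℕ → ℝ) : mean n (fun S => u S.size) = u n := by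
  rw [mean, total_size, mul_div_cancel_left₀ _ (histories_pos n).ne']

lemma mean_const (n : ℕ) (c : ℝ) : mean n (fun _ => c) = c := mean_size n fun _ => c

lemma mean_succ (n : ℕ) (φ : Tree → ℝ) :
    mean (n + 1) φ = mean n (fun T => T.grow φ) / (2 * n + 1) := by
  rw [mean, mean, histories_succ, div_div]; rfl

lemma mean_prodNode_le (n : ℕ) {f : Fin 3 → Tree → ℝ} {u : Fin 3 → ℕ → ℝ}
    (h0 : ∀ i S, 0 ≤ f i S) (h : ∀ i, ∀ m ≤ n, mean m (f i) ≤ u i m) :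
    mean (n + 1) (prodNode f) ≤ mean (n + 1) (prodNode fun i S => u i S.size) := by
  refine div_le_div_of_nonneg_right (total_prodNode_le n (fun i m _ => total_nonneg m (h0 i))
    fun i m hm => ?_) (histories_pos _).le
  rw [total_size, mul_comm]
  exact (div_le_iff₀ (histories_pos m)).1 (h i m hm)

/-- The value of `f` at the `i`-th subtree. -/
def child (i : Fin 3) (f : Tree → ℝ) : Tree → ℝ
  | leaf => 0
  | node t => f (t i)

/-- The product comparison with the two other factors equal to 1: a bound on means by a function of
the size passes to a subtree of random size. -/
lemma mean_child_le (n : ℕ) (i : Fin 3) {f : Tree → ℝ} {u : ℕ → ℝ}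
    (h0 : ∀ S, 0 ≤ f S) (h : ∀ m ≤ n, mean m f ≤ u m) :
    mean (n + 1) (child i f) ≤ mean (n + 1) (child i fun S => u S.size) := by
  have key := mean_prodNode_le n (f := fun j => if j = i then f else fun _ => 1)
    (u := fun j => if j = i then u else fun _ => 1)
    (fun j S => by split_ifs <;> simp [h0])
    (fun j m hm => by
      split_ifs
      · exact h m hm
      · exact (mean_const m 1).le)
  have e : ∀ (F : Tree → ℝ) (n : ℕ), mean (n + 1) (child i F) =
      mean (n + 1) (prodNode fun j S => if j = i then F S else 1) := fun F n => by
    rw [mean, mean]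
    congr 1
    refine total_succ_congr fun t => ?_
    simp [child, prodNode]
  rw [e, e]
  convert key using 3
  · funext j S; split_ifs <;> rfl
  · funext j S; split_ifs <;> rfl

lemma mean_child_mul_child_le (n : ℕ) {i j : Fin 3} (hij : i ≠ j) {f : Tree → ℝ} {u : ℕ → ℝ}
    (h0 : ∀ S, 0 ≤ f S) (h : ∀ m ≤ n, mean m f ≤ u m) :
    mean (n + 1) (fun T => child i f T * child j f T) ≤
      mean (n + 1) fun T => child i (fun S => u S.size) T * child j (fun S => u S.size) T := by
  have key := mean_prodNode_le n (f := fun k => if k = i ∨ k = j then f else fun _ => 1)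
    (u := fun k => if k = i ∨ k = j then u else fun _ => 1)
    (fun j S => by split_ifs <;> simp [h0])
    (fun j m hm => by
      split_ifs
      · exact h m hm
      · exact (mean_const m 1).le)
  have e : ∀ (F : Tree → ℝ) (n : ℕ), mean (n + 1) (fun T => child i F T * child j F T) =
      mean (n + 1) (prodNode fun k S => if k = i ∨ k = j then F S else 1) := fun F n => by
    rw [mean, mean]
    congr 1
    refine total_succ_congr fun t => ?_
    simp only [child, prodNode, Finset.prod_ite, Finset.prod_const_one, mul_one]
    have : Finset.univ.filter (fun k => k = i ∨ k = j) = {i, j} := by ext; simp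
    rw [this, Finset.prod_pair hij]
  rw [e, e]
  convert key using 3
  · funext j S; split_ifs <;> rfl
  · funext j S; split_ifs <;> rfl

end Tree

namespace Tree

/-! ### Moments of the sizes of subtrees -/

lemma child_node (i : Fin 3) (f : Tree → ℝ) (t : Fin 3 → Tree) : child i f (node t) = f (t i) :=
  rfl

lemma grow_child (i : Fin 3) (f : Tree → ℝ) (t : Fin 3 → Tree) :
    (node t).grow (child i f) = (t i).grow f + ((node t).leaves - (t i).leaves) * f (t i) := by
  simp only [grow, child]
  rw [← Finset.add_sum_erase _ _ (Finset.mem_univ i), leaves_node,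
    ← Finset.add_sum_erase _ (fun j => (t j).leaves) (Finset.mem_univ i), add_sub_cancel_left,
    Finset.sum_mul]
  congr 1
  · simp
  · refine Finset.sum_congr rfl fun j hj => ?_
    simp [Function.update_of_ne (Finset.ne_of_mem_erase hj).symm, grow_const]

lemma grow_leaves_mul (T : Tree) :
    T.grow (fun S => S.leaves * (S.leaves + 2)) =
      T.leaves * ((T.leaves + 2) * (T.leaves + 4)) := by
  have := grow_size T fun k => (2 * (k : ℝ) + 1) * (2 * (k : ℝ) + 1 + 2)
  simp only [leaves] at *
  rw [this]; push_cast; ring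

/-- With L leaves in all and Lᵢ in a subtree, one step turns Lᵢ(Lᵢ+2) into Lᵢ(Lᵢ+2)(Lᵢ+4) +
(L-Lᵢ)Lᵢ(Lᵢ+2) = (L+4)Lᵢ(Lᵢ+2). The rising product is thus an eigenfunction and its mean is computed
exactly; 3/5 comes from the first tree, where 9 = 3/5·3·5. -/
lemma mean_sum_leaves_mul (n : ℕ) :
    mean (n + 1) (fun T => ∑ i, child i (fun S => S.leaves * (S.leaves + 2)) T) =
      3 / 5 * ((2 * n + 3) * (2 * n + 5)) := by
  induction n with
  | zero =>
    simp [mean, total, grow, child, leaves, size, histories]; norm_num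
  | succ n ih =>
    rw [mean_succ]
    have h : ∀ S : Tree, S.size = n + 1 →
        S.grow (fun T => ∑ i, child i (fun S => S.leaves * (S.leaves + 2)) T) =
          (2 * n + 7) * ∑ i, child i (fun S => S.leaves * (S.leaves + 2)) S := by
      intro S hS
      have hl : S.leaves = 2 * n + 3 := by simp only [leaves, hS]; push_cast; ring
      cases S with
      | leaf => simp [size] at hS
      | node t =>
        simp only [Fin.sum_univ_three, grow_add, grow_child, grow_leaves_mul, hl, child_node]
        ring
    rw [mean_congr _ h, mean_const_mul, ih]
    push_cast
    field_simp
    ring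

lemma mean_sum_leaves_sq_le (n : ℕ) :
    mean (n + 1) (fun T => ∑ i, child i (fun S => S.leaves ^ 2) T) ≤
      3 / 5 * (2 * ((n + 1 : ℕ) : ℝ) + 1) ^ 2 := by
  have h := mean_sum_leaves_mul n
  have e : mean (n + 1) (fun T => ∑ i, child i (fun S => S.leaves * (S.leaves + 2)) T) =
      mean (n + 1) (fun T => (∑ i, child i (fun S => S.leaves ^ 2) T) + 2 * T.leaves) := by
    refine mean_congr _ fun S hS => ?_
    cases S with
    | leaf => simp [size] at hS
    | node t =>
      simp only [child, leaves_node, Finset.mul_sum, ← Finset.sum_add_distrib]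
      exact Finset.sum_congr rfl fun i _ => by ring
  rw [e, mean_add, mean_const_mul,
    show mean (n + 1) leaves = 2 * ((n + 1 : ℕ) : ℝ) + 1 from
      mean_size (n + 1) fun k => 2 * (k : ℝ) + 1] at h
  push_cast at *
  nlinarith

/-- By the Leibniz rule the excess growth c adds up over the three factors. Starting from c = 2 for
`leaves`, two applications give 6 and then 18. -/
lemma le_grow_prodNode {c : ℝ} {f : Tree → ℝ} (h0 : ∀ S, 0 ≤ f S)
    (h : ∀ S : Tree, (S.leaves + c) * f S ≤ S.grow f) (T : Tree) :
    (T.leaves + 3 * c) * prodNode (fun _ => f) T ≤ T.grow (prodNode fun _ => f) := by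
  cases T with
  | leaf => simpa [prodNode, grow] using pow_nonneg (h0 leaf) 3
  | node t =>
    rw [grow_prodNode, leaves_node]
    simp only [prodNode, Fin.sum_univ_three, Fin.prod_univ_three, Function.update_apply]
    simp
    have a := mul_le_mul_of_nonneg_right (h (t 0)) (mul_nonneg (h0 (t 1)) (h0 (t 2)))
    have b := mul_le_mul_of_nonneg_right (h (t 1)) (mul_nonneg (h0 (t 0)) (h0 (t 2)))
    have d := mul_le_mul_of_nonneg_right (h (t 2)) (mul_nonneg (h0 (t 0)) (h0 (t 1)))
    linarith

/-- The product of the numbers of leaves of the three subtrees. -/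
def leafProd : Tree → ℝ := prodNode fun _ => leaves

/-- The product of the numbers of leaves of the nine subtrees at depth two. -/
def leafProd₂ : Tree → ℝ := prodNode fun _ => leafProd

lemma prodNode_nonneg {f : Fin 3 → Tree → ℝ} (h : ∀ i S, 0 ≤ f i S) (T : Tree) :
    0 ≤ prodNode f T := by
  cases T with
  | leaf => exact le_rfl
  | node t => exact Finset.prod_nonneg fun i _ => h i _

lemma leaves_pos (T : Tree) : 0 < T.leaves := zero_lt_one.trans_le T.one_le_leaves

lemma leafProd_nonneg (T : Tree) : 0 ≤ leafProd T :=
  prodNode_nonneg (fun _ S => S.leaves_pos.le) T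

lemma le_grow_leafProd₂ (T : Tree) :
    (T.leaves + 18) * leafProd₂ T ≤ T.grow leafProd₂ := by
  have h1 : ∀ S : Tree, (S.leaves + 2) * leaves S ≤ S.grow leaves := fun S => by
    have := grow_size S fun k => 2 * (k : ℝ) + 1
    change S.grow leaves = _ at this
    rw [this]; simp only [leaves]; push_cast; exact le_of_eq (by ring)
  have h2 := le_grow_prodNode (fun S => S.leaves_pos.le) h1
  have h3 := le_grow_prodNode leafProd_nonneg h2
  norm_num at h3
  exact h3 T

/-- Only the 3! histories that expand the root and then its three children contribute, each with
product 1. -/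
lemma total_four_leafProd₂ : total 4 leafProd₂ = 6 := by
  have h0 : leafProd leaf = 0 := rfl
  have h1 : leaf.grow leafProd = 1 := by
    simp [grow, leafProd, prodNode, leaves, size]
  have e : ∀ f, total 1 (prodNode f) = ∏ i, f i leaf := fun f => rfl
  simp only [leafProd₂, total_prodNode_succ, e, Fin.sum_univ_three, Fin.prod_univ_three]
  simp [h0, h1]
  norm_num

/-- Each step multiplies the mean by at least (2n+19)/(2n+1), which is the ratio of consecutive
values of (2n+1)(2n+3)⋯(2n+17). The constant is the value at n = 4, namely 6 over 105 histories,
divided by 9·11⋯25. -/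
lemma le_mean_leafProd₂ (n : ℕ) (hn : 4 ≤ n) :
    (6 / 105 / (9 * 11 * 13 * 15 * 17 * 19 * 21 * 23 * 25)) * (2 * (n : ℝ) + 1) ^ 9 ≤
      mean n leafProd₂ := by
  have key : (6 / 105 / (9 * 11 * 13 * 15 * 17 * 19 * 21 * 23 * 25)) *
      ∏ j ∈ Finset.range 9, (2 * (n : ℝ) + 1 + 2 * j) ≤ mean n leafProd₂ := by
    induction n, hn using Nat.le_induction with
    | base =>
      rw [mean, total_four_leafProd₂]
      simp [histories, Finset.prod_range_succ]; norm_num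
    | succ n hn ih =>
      rw [mean_succ, le_div_iff₀ (by positivity)]
      have h : mean n (fun T => (2 * (n : ℝ) + 1 + 18) * leafProd₂ T) ≤
          mean n fun T => T.grow leafProd₂ := mean_mono n fun S hS => by
        have := le_grow_leafProd₂ S
        rwa [leaves, hS] at this
      rw [mean_const_mul] at h
      refine le_trans ?_ h
      refine le_trans (le_of_eq ?_) (mul_le_mul_of_nonneg_left ih (by positivity))
      simp only [Finset.prod_range_succ, Finset.prod_range_zero]
      push_cast
      ring
  refine le_trans (mul_le_mul_of_nonneg_left ?_ (by norm_num)) key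
  calc (2 * (n : ℝ) + 1) ^ 9 = ∏ j ∈ Finset.range 9, (2 * (n : ℝ) + 1) := by simp
    _ ≤ _ := Finset.prod_le_prod (fun _ _ => by positivity) fun j _ => by
      have : (0 : ℝ) ≤ j := Nat.cast_nonneg j
      linarith

lemma prod_le_sum_div_pow {ι : Type*} (s : Finset ι) (hs : s.card ≠ 0) {x : ι → ℝ}
    (hx : ∀ i ∈ s, 0 ≤ x i) : ∏ i ∈ s, x i ≤ ((∑ i ∈ s, x i) / s.card) ^ s.card := by
  have hc : (0 : ℝ) < s.card := by positivity
  have := Real.geom_mean_le_arith_mean s (fun _ => (1 : ℝ)) x (fun _ _ => zero_le_one)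
    (by simpa using hc) hx
  simp only [Real.rpow_one, Finset.sum_const, nsmul_eq_mul, mul_one, one_mul] at this
  have hp := Finset.prod_nonneg hx
  calc ∏ i ∈ s, x i = ((∏ i ∈ s, x i) ^ ((s.card : ℝ)⁻¹)) ^ s.card := by
        rw [Real.rpow_inv_natCast_pow hp hs]
    _ ≤ _ := pow_le_pow_left₀ (Real.rpow_nonneg hp _) this _

/-- The trees all of whose nine subtrees at depth two exist. -/
def full (s : Fin 3 × Fin 3 → Tree) : Tree := node fun i => node fun j => s (i, j)

lemma leafProd₂_full (s : Fin 3 × Fin 3 → Tree) : leafProd₂ (full s) = ∏ p, (s p).leaves := by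
  simp [leafProd₂, leafProd, full, prodNode, Fintype.prod_prod_type]

lemma leaves_full (s : Fin 3 × Fin 3 → Tree) : (full s).leaves = ∑ p, (s p).leaves := by
  simp [full, leaves_node, Fintype.sum_prod_type]

/-- AM-GM on the eight factors other than c. This bounds the leaf fraction of an arbitrary dropped
subtree from below by a quantity that does not depend on c. -/
lemma leafProd₂_full_le (s : Fin 3 × Fin 3 → Tree) (c : Fin 3 × Fin 3) :
    8 ^ 8 * leafProd₂ (full s) ≤ (s c).leaves * (full s).leaves ^ 8 := by
  have h := prod_le_sum_div_pow (Finset.univ.erase c) (by simp) (x := fun p => (s p).leaves)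
    fun p _ => (s p).leaves_pos.le
  rw [leafProd₂_full, leaves_full, ← Finset.mul_prod_erase _ _ (Finset.mem_univ c)]
  have hc : (Finset.univ.erase c).card = 8 := by simp
  rw [hc, div_pow, le_div_iff₀ (by positivity)] at h
  have h2 : (∑ p ∈ Finset.univ.erase c, (s p).leaves) ^ 8 ≤ (∑ p, (s p).leaves) ^ 8 :=
    pow_le_pow_left₀ (Finset.sum_nonneg fun p _ => (s p).leaves_pos.le)
      (Finset.sum_le_sum_of_subset_of_nonneg (Finset.erase_subset _ _)
        fun p _ _ => (s p).leaves_pos.le) 8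
  have := mul_le_mul_of_nonneg_left (h.trans h2) (s c).leaves_pos.le
  push_cast at this
  linarith

end Tree

namespace Tree

/-! ### The growth of functions that lose one subtree out of nine -/

/-- The loss in the exponent. -/
def eta : ℝ := 5 / 10 ^ 8

/-- The growth rate `10⁸ (2 n + 1) ^ (1 - η)`. -/
def rate (n : ℕ) : ℝ := 10 ^ 8 * (2 * (n : ℝ) + 1) ^ (1 - eta)

lemma le_rate (n : ℕ) : 10 ^ 8 ≤ rate n := by
  have : (1 : ℝ) ≤ (2 * (n : ℝ) + 1) ^ (1 - eta) :=
    Real.one_le_rpow (by linarith [(Nat.cast_nonneg n : (0 : ℝ) ≤ n)]) (by norm_num [eta])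
  simp only [rate]; linarith

lemma rate_pos (n : ℕ) : 0 < rate n := lt_of_lt_of_le (by norm_num) (le_rate n)

lemma rate_eq (S T : Tree) :
    rate S.size = rate T.size * (S.leaves / T.leaves) ^ (1 - eta) := by
  have hT := T.leaves_pos
  have hS := S.leaves_pos
  rw [Real.div_rpow hS.le hT.le, rate, rate]
  have : T.leaves ^ (1 - eta) ≠ 0 := (Real.rpow_pos_of_pos hT _).ne'
  simp only [leaves] at *
  field_simp

/-- Weighted AM-GM linearizes the power: x^(1-η) ≤ (1-η)x + η. Summed over three subtrees, the
concavity of the rate therefore costs only 3η. -/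
lemma rate_le (S T : Tree) :
    rate S.size ≤ rate T.size * (S.leaves / T.leaves + eta) := by
  rw [rate_eq S T]
  refine mul_le_mul_of_nonneg_left ?_ (rate_pos _).le
  have hp : 0 ≤ S.leaves / T.leaves := div_nonneg S.leaves_pos.le T.leaves_pos.le
  have := Real.geom_mean_le_arith_mean2_weighted (w₁ := 1 - eta) (w₂ := eta)
    (p₁ := S.leaves / T.leaves) (p₂ := 1) (by norm_num [eta]) (by norm_num [eta]) hp zero_le_one
    (by ring)
  rw [Real.one_rpow, mul_one, mul_one] at this
  have h2 : 0 ≤ eta * (S.leaves / T.leaves) := mul_nonneg (by norm_num [eta]) hp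
  linarith

lemma le_rate_of_leaves_le {S T : Tree} (h : S.leaves ≤ T.leaves) :
    rate T.size * (S.leaves / T.leaves) ≤ rate S.size := by
  rw [rate_eq S T]
  refine mul_le_mul_of_nonneg_left ?_ (rate_pos _).le
  exact Real.self_le_rpow_of_le_one (div_nonneg S.leaves_pos.le T.leaves_pos.le)
    ((div_le_one T.leaves_pos).2 h) (by norm_num [eta])

lemma sum_rate_le (t : Fin 3 → Tree) :
    ∑ i, rate (t i).size ≤ (1 + 3 * eta) * rate (node t).size := by
  have h := Finset.sum_le_sum fun (i : Fin 3) (_ : i ∈ Finset.univ) => rate_le (t i) (node t)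
  refine h.trans (le_of_eq ?_)
  rw [← Finset.mul_sum, Finset.sum_add_distrib, ← Finset.sum_div, ← leaves_node,
    div_self (leaves_pos _).ne']
  simp; ring

lemma sum_rate_sq_le (t : Fin 3 → Tree) :
    ∑ i, rate (t i).size ^ 2 ≤ rate (node t).size ^ 2 *
      ((∑ i, (t i).leaves ^ 2) / (node t).leaves ^ 2 + 2 * eta + 3 * eta ^ 2) := by
  have h := Finset.sum_le_sum fun (i : Fin 3) (_ : i ∈ Finset.univ) =>
    pow_le_pow_left₀ (rate_pos _).le (rate_le (t i) (node t)) 2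
  refine h.trans (le_of_eq ?_)
  have e : (node t).leaves = (t 0).leaves + (t 1).leaves + (t 2).leaves := by
    rw [leaves_node, Fin.sum_univ_three]
  have := (leaves_pos (node t)).ne'
  simp only [Fin.sum_univ_three]
  field_simp
  rw [e]
  ring

/-- A function on trees that is subadditive and drops one of the nine subtrees at depth two. -/
structure Dropping (X : Tree → ℝ) : Prop where
  nonneg : ∀ T, 0 ≤ X T
  leaf : X leaf = 0
  node_le : ∀ t, X (node t) ≤ 1 + ∑ i, X (t i)
  full_le : ∀ s, ∃ c, X (full s) ≤ 4 + ∑ p ∈ Finset.univ.erase c, X (s p)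

variable {X : Tree → ℝ}

lemma Dropping.le_size (hX : Dropping X) (T : Tree) : X T ≤ T.size := by
  induction T with
  | leaf => simp [hX.leaf, size]
  | node t ih =>
    refine (hX.node_le t).trans ?_
    simp only [size]
    push_cast
    linarith [Finset.sum_le_sum fun (i : Fin 3) (_ : i ∈ Finset.univ) => ih i]

/-- A bound for the relative second moment. -/
def eps : ℝ := 1 / 10 ^ 6

lemma Dropping.mean_sq_succ_le (hX : Dropping X) (n : ℕ)
    (h1 : ∀ m ≤ n, mean m X ≤ rate m)
    (h2 : ∀ m ≤ n, mean m (fun S => X S ^ 2) ≤ (1 + eps) * rate m ^ 2) :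
    mean (n + 1) (fun S => X S ^ 2) ≤ (1 + eps) * rate (n + 1) ^ 2 := by
  -- The expansion of (1 + Σ fᵢ)² with fᵢ² replaced by gᵢ: squares are controlled by second moments,
  -- cross terms by first moments and conditional independence.
  let expand (f g : Tree → ℝ) (T : Tree) : ℝ :=
    1 + (2 * ∑ i, child i f T + (∑ i, child i g T +
      2 * (child 0 f T * child 1 f T + (child 0 f T * child 2 f T + child 1 f T * child 2 f T))))
  have mean_expand : ∀ f g : Tree → ℝ, mean (n + 1) (expand f g) =
      1 + (2 * ∑ i, mean (n + 1) (child i f) + (∑ i, mean (n + 1) (child i g) +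
        2 * (mean (n + 1) (fun T => child 0 f T * child 1 f T) +
          (mean (n + 1) (fun T => child 0 f T * child 2 f T) +
            mean (n + 1) (fun T => child 1 f T * child 2 f T))))) := by
    intro f g
    simp only [expand, mean_add, mean_const_mul, mean_sum, mean_const]
  have a1 : mean (n + 1) (fun S => X S ^ 2) ≤ mean (n + 1) (expand X fun S => X S ^ 2) := by
    refine mean_mono _ fun S hS => ?_
    cases S with
    | leaf => simp [size] at hS
    | node t =>
      refine (pow_le_pow_left₀ (hX.nonneg _) (hX.node_le t) 2).trans (le_of_eq ?_)
      simp only [expand, child_node, Fin.sum_univ_three]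
      ring
  have a2 : mean (n + 1) (expand X fun S => X S ^ 2) ≤ mean (n + 1)
      (expand (fun S => rate S.size) fun S => (1 + eps) * rate S.size ^ 2) := by
    rw [mean_expand, mean_expand]
    have b1 := fun i => mean_child_le n i hX.nonneg h1
    have b2 := fun i => mean_child_le n i (u := fun m => (1 + eps) * rate m ^ 2)
      (fun S => sq_nonneg (X S)) h2
    have b3 := fun (i j : Fin 3) (h : i ≠ j) => mean_child_mul_child_le n h hX.nonneg h1
    have c1 := Finset.sum_le_sum fun (i : Fin 3) (_ : i ∈ Finset.univ) => b1 i
    have c2 := Finset.sum_le_sum fun (i : Fin 3) (_ : i ∈ Finset.univ) => b2 i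
    linarith [b3 0 1 (by decide), b3 0 2 (by decide), b3 1 2 (by decide)]
  set Q := rate (n + 1) with hQ
  set l : ℝ := 2 * ((n + 1 : ℕ) : ℝ) + 1 with hl
  have hQ8 : 10 ^ 8 ≤ Q := le_rate _
  have hl0 : 0 < l := by positivity
  have a3 : mean (n + 1)
      (expand (fun S => rate S.size) fun S => (1 + eps) * rate S.size ^ 2) ≤
      mean (n + 1) fun T => Q ^ 2 * (1 + 7 * eta + eps * (2 * eta + 3 * eta ^ 2)) +
        eps * Q ^ 2 / l ^ 2 * ∑ i, child i (fun S => S.leaves ^ 2) T := by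
    refine mean_mono _ fun S hS => ?_
    cases S with
    | leaf => simp [size] at hS
    | node t =>
      have d1 := sum_rate_le t
      have d2 := sum_rate_sq_le t
      have d3 : (0 : ℝ) ≤ ∑ i, rate (t i).size := Finset.sum_nonneg fun i _ => (rate_pos _).le
      have hlS : (node t).leaves = l := by rw [leaves, hS]
      rw [hS, ← hQ] at d1 d2
      rw [hlS] at d2
      -- The additive 1 is absorbed because Q ≥ 10⁸ gives 0.3·η·Q ≥ 1.5; this is one use of the
      -- factor 10⁸ in the rate.
      have d4 : (1 + ∑ i, rate (t i).size) ^ 2 ≤ ((1 + 33 / 10 * eta) * Q) ^ 2 := by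
        refine pow_le_pow_left₀ (by linarith) ?_ 2
        have : 1 ≤ 3 / 10 * eta * Q := by simp only [eta]; linarith
        linarith
      have d5 : ((1 + 33 / 10 * eta) * Q) ^ 2 ≤ (1 + 7 * eta) * Q ^ 2 := by
        rw [mul_pow]
        exact mul_le_mul_of_nonneg_right (by norm_num [eta]) (sq_nonneg _)
      have d6 := mul_le_mul_of_nonneg_left d2 (by norm_num [eps] : 0 ≤ eps)
      have e1 : expand (fun S => rate S.size) (fun S => (1 + eps) * rate S.size ^ 2) (node t) =
          (1 + ∑ i, rate (t i).size) ^ 2 + eps * ∑ i, rate (t i).size ^ 2 := by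
        simp only [expand, child_node, Fin.sum_univ_three]; ring
      rw [e1]
      simp only [child_node]
      have e2 : eps * (Q ^ 2 * ((∑ i, (t i).leaves ^ 2) / l ^ 2 + 2 * eta + 3 * eta ^ 2)) =
          Q ^ 2 * (eps * (2 * eta + 3 * eta ^ 2)) +
            eps * Q ^ 2 / l ^ 2 * ∑ i, (t i).leaves ^ 2 := by ring
      linarith
  refine (a1.trans a2).trans (a3.trans ?_)
  rw [mean_add, mean_const, mean_const_mul]
  have h5 : eps * Q ^ 2 / l ^ 2 *
      mean (n + 1) (fun T => ∑ i, child i (fun S => S.leaves ^ 2) T) ≤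
      eps * Q ^ 2 / l ^ 2 * (3 / 5 * l ^ 2) :=
    mul_le_mul_of_nonneg_left (mean_sum_leaves_sq_le n)
      (div_nonneg (mul_nonneg (by norm_num [eps]) (sq_nonneg _)) (sq_nonneg _))
  have h6 : eps * Q ^ 2 / l ^ 2 * (3 / 5 * l ^ 2) = 3 / 5 * eps * Q ^ 2 := by field_simp
  -- The induction closes since the error 7η = 3.5·10⁻⁷ fits, with the tiny mixed term, into the
  -- slack 2ε/5 = 4·10⁻⁷ left by the contraction factor 3/5.
  have h7 : (1 + 7 * eta + eps * (2 * eta + 3 * eta ^ 2) + 3 / 5 * eps) * Q ^ 2 ≤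
      (1 + eps) * Q ^ 2 :=
    mul_le_mul_of_nonneg_right (by norm_num [eta, eps]) (sq_nonneg _)
  linarith

/-- A quadratic upper bound for `X`. -/
def quad (X : Tree → ℝ) (S : Tree) : ℝ := rate S.size / 2 + X S ^ 2 / (2 * rate S.size)

lemma le_quad (S : Tree) : X S ≤ quad X S := by
  have h := rate_pos S.size
  rw [quad, div_add_div _ _ two_ne_zero (by positivity), le_div_iff₀ (by positivity)]
  nlinarith [sq_nonneg (rate S.size - X S)]

lemma half_rate_le_quad (S : Tree) : rate S.size / 2 ≤ quad X S := by
  have h := rate_pos S.size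
  have : 0 ≤ X S ^ 2 / (2 * rate S.size) := by positivity
  rw [quad]; linarith

lemma quad_nonneg (S : Tree) : 0 ≤ quad X S :=
  (half_pos (rate_pos S.size)).le.trans (half_rate_le_quad S)

lemma mean_quad_le {n : ℕ} (h : mean n (fun S => X S ^ 2) ≤ (1 + eps) * rate n ^ 2) :
    mean n (quad X) ≤ (1 + eps / 2) * rate n := by
  have hr := rate_pos n
  have e : mean n (quad X) =
      mean n fun S => rate n / 2 + 1 / (2 * rate n) * X S ^ 2 :=
    mean_congr n fun S hS => by rw [quad, hS]; ring
  rw [e, mean_add, mean_const, mean_const_mul]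
  have := mul_le_mul_of_nonneg_left h (by positivity : 0 ≤ 1 / (2 * rate n))
  have e2 : 1 / (2 * rate n) * ((1 + eps) * rate n ^ 2) = (1 + eps) / 2 * rate n := by
    field_simp
  linarith

/-- In a full tree, omitting subtree c saves `quad X (s c)`, which is at least half its rate
whatever X does there, hence at least half the rate of the whole tree times the leaf fraction of c.
Otherwise the subtracted product vanishes and subadditivity suffices. -/
lemma Dropping.node_le_quad (hX : Dropping X) (t : Fin 3 → Tree) :
    X (node t) ≤ 4 + ∑ i, child i (fun S => ∑ j, child j (quad X) S) (node t) -
      rate (node t).size / 2 * (8 ^ 8 * leafProd₂ (node t) / (node t).leaves ^ 9) := by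
  by_cases h : ∃ s, node t = full s
  · obtain ⟨s, hs⟩ := h
    rw [hs]
    obtain ⟨c, hc⟩ := hX.full_le s
    have e : ∑ i, child i (fun S => ∑ j, child j (quad X) S) (full s) = ∑ p, quad X (s p) := by
      simp [full, child_node, Fintype.sum_prod_type]
    rw [e, ← Finset.add_sum_erase _ _ (Finset.mem_univ c)]
    have h1 : ∑ p ∈ Finset.univ.erase c, X (s p) ≤ ∑ p ∈ Finset.univ.erase c, quad X (s p) :=
      Finset.sum_le_sum fun p _ => le_quad _
    have h2 := half_rate_le_quad (X := X) (s c)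
    have hl := leaves_pos (full s)
    have h3 : rate (full s).size * ((s c).leaves / (full s).leaves) ≤ rate (s c).size := by
      refine le_rate_of_leaves_le ?_
      rw [leaves_full]
      exact Finset.single_le_sum (f := fun p => (s p).leaves) (fun p _ => (s p).leaves_pos.le)
        (Finset.mem_univ c)
    have h4 : 8 ^ 8 * leafProd₂ (full s) / (full s).leaves ^ 9 ≤
        (s c).leaves / (full s).leaves := by
      rw [div_le_div_iff₀ (by positivity) hl]
      have := mul_le_mul_of_nonneg_right (leafProd₂_full_le s c) hl.le
      linarith
    have h5 := mul_le_mul_of_nonneg_left h4 (rate_pos (full s).size).le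
    linarith
  · have h0 : leafProd₂ (node t) = 0 := by
      have : ∃ i, t i = Tree.leaf := by
        by_contra! h'
        refine h ?_
        have : ∀ i, ∃ r, t i = node r := fun i => by
          rcases hi : t i with _ | r
          · exact absurd hi (h' i)
          · exact ⟨r, rfl⟩
        choose r hr using this
        exact ⟨fun p => r p.1 p.2, by simp [full, funext hr]⟩
      obtain ⟨i, hi⟩ := this
      exact Finset.prod_eq_zero (f := fun i => leafProd (t i)) (Finset.mem_univ i)
        (by simp only [hi]; rfl)
    rw [h0]
    have h1 : ∀ S, X S ≤ 1 + ∑ j, child j (quad X) S := fun S => by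
      cases S with
      | leaf => simp [hX.leaf, child]
      | node r =>
        simp only [child_node]
        exact (hX.node_le r).trans (by gcongr; exact le_quad _)
    have h2 := Finset.sum_le_sum fun (i : Fin 3) (_ : i ∈ Finset.univ) => h1 (t i)
    rw [Finset.sum_add_distrib] at h2
    simp only [Finset.sum_const, Finset.card_univ, Fintype.card_fin] at h2
    have := hX.node_le t
    simp only [child_node (f := fun S => ∑ j, child j (quad X) S)]
    norm_num at h2 ⊢
    linarith

lemma mean_sum_child_rate_le (n : ℕ) {c : ℝ} (hc : 0 ≤ c) :
    mean (n + 1) (fun T => ∑ i, child i (fun S => c * rate S.size) T) ≤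
      c * (1 + 3 * eta) * rate (n + 1) := by
  rw [← mean_const (n + 1) (c * (1 + 3 * eta) * rate (n + 1))]
  refine mean_mono _ fun S hS => ?_
  cases S with
  | leaf => simp [size] at hS
  | node t =>
    simp only [child_node, ← Finset.mul_sum, ← hS]
    linarith [mul_le_mul_of_nonneg_left (sum_rate_le t) hc]

lemma child_nonneg {f : Tree → ℝ} (h : ∀ S, 0 ≤ f S) (i : Fin 3) (T : Tree) :
    0 ≤ child i f T := by
  cases T with
  | leaf => exact le_rfl
  | node t => exact h _

lemma Dropping.mean_succ_le (hX : Dropping X) (n : ℕ)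
    (h2 : ∀ m ≤ n, mean m (fun S => X S ^ 2) ≤ (1 + eps) * rate m ^ 2) :
    mean (n + 1) X ≤ rate (n + 1) := by
  have hQ8 := le_rate (n + 1)
  -- The product bound starts at four steps. Below that, X is at most the size, far less than 10⁸.
  by_cases hn : n + 1 < 4
  · rw [← mean_const (n + 1) (rate (n + 1))]
    refine mean_mono _ fun S hS => (hX.le_size S).trans ?_
    rw [hS]
    have : ((n + 1 : ℕ) : ℝ) ≤ 4 := by exact_mod_cast hn.le
    linarith
  have h3 : ∀ m ≤ n, mean m (fun S => ∑ j, child j (quad X) S) ≤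
      (1 + eps / 2) * (1 + 3 * eta) * rate m := by
    intro m hm
    cases m with
    | zero =>
      have : mean 0 (fun S => ∑ j, child j (quad X) S) = 0 := by simp [mean, total, child]
      rw [this]
      exact mul_nonneg (by norm_num [eta, eps]) (rate_pos 0).le
    | succ m =>
      refine le_trans ?_ (mean_sum_child_rate_le m (by norm_num [eps]))
      rw [mean_sum, mean_sum]
      exact Finset.sum_le_sum fun j _ => mean_child_le m j quad_nonneg
        (u := fun k => (1 + eps / 2) * rate k)
        fun k hk => mean_quad_le (h2 k (by omega))
  set l : ℝ := 2 * ((n + 1 : ℕ) : ℝ) + 1 with hl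
  have hl0 : 0 < l := by positivity
  have h4 : mean (n + 1) X ≤ mean (n + 1) fun T =>
      (4 + ∑ i, child i (fun S => ∑ j, child j (quad X) S) T) +
        (-(rate (n + 1) / 2 * (8 ^ 8 / l ^ 9))) * leafProd₂ T := by
    refine mean_mono _ fun S hS => ?_
    cases S with
    | leaf => simp [size] at hS
    | node t =>
      refine (hX.node_le_quad t).trans (le_of_eq ?_)
      rw [hS, show (node t).leaves = l by rw [leaves, hS]]
      ring
  rw [mean_add, mean_add, mean_const, mean_const_mul] at h4
  have h5 : mean (n + 1) (fun T => ∑ i, child i (fun S => ∑ j, child j (quad X) S) T) ≤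
      (1 + eps / 2) * (1 + 3 * eta) * (1 + 3 * eta) * rate (n + 1) := by
    refine le_trans ?_ (mean_sum_child_rate_le n (by norm_num [eps, eta]))
    rw [mean_sum, mean_sum]
    exact Finset.sum_le_sum fun j _ => mean_child_le n j
      (fun S => Finset.sum_nonneg fun j _ => child_nonneg quad_nonneg j S)
      (u := fun k => (1 + eps / 2) * (1 + 3 * eta) * rate k) h3
  have h6 := mul_le_mul_of_nonneg_left (le_mean_leafProd₂ (n + 1) (by omega))
    (by have := rate_pos (n + 1); positivity : 0 ≤ rate (n + 1) / 2 * (8 ^ 8 / l ^ 9))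
  rw [← hl] at h6
  have h7 : rate (n + 1) / 2 * (8 ^ 8 / l ^ 9) *
      (6 / 105 / (9 * 11 * 13 * 15 * 17 * 19 * 21 * 23 * 25) * l ^ 9) =
      rate (n + 1) * (8 ^ 8 / 2 * (6 / 105 / (9 * 11 * 13 * 15 * 17 * 19 * 21 * 23 * 25))) := by
    field_simp
  -- The excess 4·10⁻⁸ + ε/2 + 6η is about 0.84·10⁻⁶; the saving from the dropped subtree is about
  -- 6.4·10⁻⁶.
  have h8 : rate (n + 1) * (4 / 10 ^ 8 + (1 + eps / 2) * (1 + 3 * eta) * (1 + 3 * eta) -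
      8 ^ 8 / 2 * (6 / 105 / (9 * 11 * 13 * 15 * 17 * 19 * 21 * 23 * 25))) ≤
      rate (n + 1) * 1 :=
    mul_le_mul_of_nonneg_left (by norm_num [eps, eta]) (rate_pos _).le
  linarith

/-- The expectation of a dropping function grows at most like `n ^ (1 - η)`. -/
theorem Dropping.mean_le (hX : Dropping X) (n : ℕ) : mean n X ≤ rate n := by
  suffices h : mean n X ≤ rate n ∧ mean n (fun S => X S ^ 2) ≤ (1 + eps) * rate n ^ 2 from h.1
  induction n using Nat.strong_induction_on with
  | _ n ih =>
    cases n with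
    | zero =>
      have h0 : ∀ f, mean 0 f = f Tree.leaf := fun f => by simp [mean, total, histories]
      rw [h0, h0, hX.leaf]
      exact ⟨(rate_pos 0).le, by have := rate_pos 0; norm_num [eps]; positivity⟩
    | succ n =>
      have h1 := fun m (hm : m ≤ n) => (ih m (by omega)).1
      have h2 := fun m (hm : m ≤ n) => (ih m (by omega)).2
      exact ⟨hX.mean_succ_le n h2, hX.mean_sq_succ_le n h1 h2⟩

end Tree

/-! ### The number of inner vertices on a path -/

namespace Tree

/-- The bound for the tree, and the bounds for its three subtrees unless it is a leaf. -/
def pathBoundAux : Tree → ℕ × Option (Fin 3 → ℕ)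
  | leaf => (0, none)
  | node t =>
    -- The second component carries the children's bounds upward, so that the recursion sees
    -- grandchildren while remaining structural.
    let r := fun i => (t i).pathBoundAux
    (if ∀ i, (r i).2.isSome then
      min (1 + ∑ i, (r i).1) (4 + Finset.univ.sup fun c : Fin 3 × Fin 3 =>
        ∑ p ∈ Finset.univ.erase c, ((r p.1).2.getD 0) p.2)
    else 1 + ∑ i, (r i).1, some fun i => (r i).1)

/-- An upper bound for the number of inner vertices that a path can visit in a triangle whose
subdivisions are recorded by the tree. -/
def pathBound (T : Tree) : ℕ := T.pathBoundAux.1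

lemma pathBoundAux_snd_node (t : Fin 3 → Tree) :
    (node t).pathBoundAux.2 = some fun i => (t i).pathBound := rfl

lemma pathBound_full (s : Fin 3 × Fin 3 → Tree) :
    (full s).pathBound = min (1 + ∑ i, (node fun j => s (i, j)).pathBound)
      (4 + Finset.univ.sup fun c : Fin 3 × Fin 3 =>
        ∑ p ∈ Finset.univ.erase c, (s p).pathBound) := by
  rw [pathBound, full, pathBoundAux]
  simp only [pathBoundAux_snd_node, Option.isSome_some, implies_true, if_true, Option.getD_some]
  rfl

lemma pathBound_node_le (t : Fin 3 → Tree) :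
    (node t).pathBound ≤ 1 + ∑ i, (t i).pathBound := by
  rw [pathBound, pathBoundAux]
  dsimp only
  split_ifs
  · exact min_le_left _ _
  · exact le_rfl

lemma le_pathBound_node {t : Fin 3 → Tree} {n : ℕ} (h1 : n ≤ 1 + ∑ i, (t i).pathBound)
    (h2 : ∀ s, node t = full s →
      ∃ c, n ≤ 4 + ∑ p ∈ Finset.univ.erase c, (s p).pathBound) : n ≤ (node t).pathBound := by
  by_cases h : ∀ i, (t i).pathBoundAux.2.isSome
  · have : ∀ i, ∃ r, t i = node r := fun i => by
      rcases hi : t i with _ | r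
      · have := h i
        simp [hi, pathBoundAux] at this
      · exact ⟨r, rfl⟩
    choose r hr using this
    have hs : node t = full fun p => r p.1 p.2 := by simp [full, funext hr]
    obtain ⟨c, hc⟩ := h2 _ hs
    rw [hs, pathBound_full]
    refine le_min ?_ (hc.trans ?_)
    · simpa [hr] using h1
    · exact Nat.add_le_add_left (Finset.le_sup (f := fun c : Fin 3 × Fin 3 =>
        ∑ p ∈ Finset.univ.erase c, (r p.1 p.2).pathBound) (Finset.mem_univ c)) 4
  · rw [pathBound, pathBoundAux]
    dsimp only
    rw [if_neg h]
    exact h1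

lemma dropping_pathBound : Dropping fun T => (T.pathBound : ℝ) where
  nonneg T := Nat.cast_nonneg _
  leaf := by simp [pathBound, pathBoundAux]
  node_le t := by exact_mod_cast pathBound_node_le t
  full_le s := by
    obtain ⟨c, -, hc⟩ := Finset.exists_mem_eq_sup Finset.univ Finset.univ_nonempty
      fun c : Fin 3 × Fin 3 => ∑ p ∈ Finset.univ.erase c, (s p).pathBound
    refine ⟨c, ?_⟩
    have := (pathBound_full s).le.trans (min_le_right _ _)
    rw [hc] at this
    exact_mod_cast this

end Tree

/-- A ternary tree whose internal nodes are labelled by the vertices that were added. -/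
inductive LTree where
  | leaf : LTree
  | node : ℕ → (Fin 3 → LTree) → LTree

/-- The vertex set of a triangle. -/
def tri (x : Fin 3 → ℕ) : Finset ℕ := Finset.univ.image x

lemma mem_tri {x : Fin 3 → ℕ} {u : ℕ} : u ∈ tri x ↔ ∃ i, x i = u := by simp [tri]

lemma card_tri {x : Fin 3 → ℕ} (hx : x.Injective) : (tri x).card = 3 := by
  simp [tri, Finset.card_image_of_injective _ hx]

lemma tri_update {x : Fin 3 → ℕ} (hx : x.Injective) (i : Fin 3) (v : ℕ) :
    tri (Function.update x i v) = insert v ((tri x).erase (x i)) := by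
  ext u
  simp only [mem_tri, Finset.mem_insert, Finset.mem_erase]
  constructor
  · rintro ⟨j, rfl⟩
    rcases eq_or_ne j i with rfl | hj
    · simp
    · right
      rw [Function.update_of_ne hj]
      exact ⟨fun h => hj (hx h), j, rfl⟩
  · rintro (rfl | ⟨h, j, rfl⟩)
    · exact ⟨i, by simp⟩
    · exact ⟨j, Function.update_of_ne (fun h' => h (by rw [h'])) _ _⟩

lemma tri_update_subset (x : Fin 3 → ℕ) (i : Fin 3) (v : ℕ) :
    tri (Function.update x i v) ⊆ insert v (tri x) := by
  intro u hu
  obtain ⟨j, rfl⟩ := mem_tri.1 hu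
  rcases eq_or_ne j i with rfl | hj
  · simp
  · rw [Function.update_of_ne hj]
    exact Finset.mem_insert_of_mem (mem_tri.2 ⟨j, rfl⟩)

lemma injective_update {x : Fin 3 → ℕ} (hx : x.Injective) (i : Fin 3) {v : ℕ} (hv : v ∉ tri x) :
    (Function.update x i v).Injective := by
  intro j k h
  rcases eq_or_ne j i with rfl | hj <;> rcases eq_or_ne k j with rfl | hk
  · rfl
  · rw [Function.update_self, Function.update_of_ne hk] at h
    exact absurd (mem_tri.2 ⟨k, h.symm⟩) hv
  · rfl
  · rw [Function.update_of_ne hj] at h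
    rcases eq_or_ne k i with rfl | hk'
    · rw [Function.update_self] at h
      exact absurd (mem_tri.2 ⟨j, h⟩) hv
    · rw [Function.update_of_ne hk'] at h
      exact hx h

/-! ### Labelled trees and the faces they describe -/

namespace LTree

/-- The tree without labels. -/
def shape : LTree → Tree
  | leaf => .leaf
  | node _ t => .node fun i => (t i).shape

/-- The inner vertices. -/
def lab : LTree → Finset ℕ
  | leaf => ∅
  | node v t => insert v (Finset.univ.biUnion fun i => (t i).lab)

/-- The faces into which the triangle `x` has been subdivided. -/
def fc : (Fin 3 → ℕ) → LTree → Finset (Finset ℕ)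
  | x, leaf => {tri x}
  | x, node v t => Finset.univ.biUnion fun i => fc (Function.update x i v) (t i)

/-- Subdivision of the face `f` of the triangle `x` by the new vertex `n`. -/
def ins (f : Finset ℕ) (n : ℕ) : (Fin 3 → ℕ) → LTree → LTree
  | x, leaf => if tri x = f then node n fun _ => leaf else leaf
  | x, node v t => node v fun i => ins f n (Function.update x i v) (t i)

/-- All labels are distinct, and distinct from the vertices of the triangle. -/
def Valid : (Fin 3 → ℕ) → LTree → Prop
  | _, leaf => True
  | x, node v t => v ∉ tri x ∧ (∀ i, Valid (Function.update x i v) (t i)) ∧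
      (∀ i, Disjoint (t i).lab (insert v (tri x))) ∧
      ∀ i j, i ≠ j → Disjoint (t i).lab (t j).lab

lemma mem_fc_node {x : Fin 3 → ℕ} {v : ℕ} {t : Fin 3 → LTree} {f : Finset ℕ} :
    f ∈ fc x (node v t) ↔ ∃ i, f ∈ fc (Function.update x i v) (t i) := by simp [fc]

lemma mem_lab_node {v : ℕ} {t : Fin 3 → LTree} {u : ℕ} :
    u ∈ (node v t).lab ↔ u = v ∨ ∃ i, u ∈ (t i).lab := by simp [lab]

lemma fc_subset {x : Fin 3 → ℕ} {T : LTree} {f : Finset ℕ} (hf : f ∈ fc x T) :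
    f ⊆ tri x ∪ T.lab := by
  induction T generalizing x with
  | leaf => simp only [fc, Finset.mem_singleton] at hf; simp [hf, lab]
  | node v t ih =>
    obtain ⟨i, hi⟩ := mem_fc_node.1 hf
    intro u hu
    rcases Finset.mem_union.1 (ih i hi hu) with h | h
    · rcases Finset.mem_insert.1 (tri_update_subset x i v h) with rfl | h
      · exact Finset.mem_union_right _ (mem_lab_node.2 (Or.inl rfl))
      · exact Finset.mem_union_left _ h
    · exact Finset.mem_union_right _ (mem_lab_node.2 (Or.inr ⟨i, h⟩))

lemma card_of_mem_fc {x : Fin 3 → ℕ} {T : LTree} {f : Finset ℕ} (hx : x.Injective)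
    (hT : Valid x T) (hf : f ∈ fc x T) : f.card = 3 := by
  induction T generalizing x with
  | leaf => simp only [fc, Finset.mem_singleton] at hf; rw [hf, card_tri hx]
  | node v t ih =>
    obtain ⟨i, hi⟩ := mem_fc_node.1 hf
    exact ih i (injective_update hx i hT.1) (hT.2.1 i) hi

/-- A face in two different subtriangles could only use their common vertices, the centre v and one
corner, but a face has three vertices. -/
lemma eq_of_mem_fc_of_mem_fc {x : Fin 3 → ℕ} {v : ℕ} {t : Fin 3 → LTree} {f : Finset ℕ}
    (hx : x.Injective) (hT : Valid x (node v t)) {i j : Fin 3}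
    (hi : f ∈ fc (Function.update x i v) (t i)) (hj : f ∈ fc (Function.update x j v) (t j)) :
    i = j := by
  by_contra hij
  obtain ⟨hv, hV, hd, hd2⟩ := hT
  have key : ∀ i j, i ≠ j → f ∈ fc (Function.update x i v) (t i) →
      f ∈ fc (Function.update x j v) (t j) → ∀ u ∈ f, u ∈ tri (Function.update x i v) := by
    intro i j hij hi hj u hu
    rcases Finset.mem_union.1 (fc_subset hi hu) with h | h
    · exact h
    · rcases Finset.mem_union.1 (fc_subset hj hu) with h' | h'
      · exact absurd (tri_update_subset x j v h') (Finset.disjoint_left.1 (hd i) h)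
      · exact absurd h' (Finset.disjoint_left.1 (hd2 i j hij) h)
  have sub : f ⊆ insert v (((tri x).erase (x i)).erase (x j)) := by
    intro u hu
    have h1 := key i j hij hi hj u hu
    have h2 := key j i (Ne.symm hij) hj hi u hu
    rw [tri_update hx] at h1 h2
    simp only [Finset.mem_insert, Finset.mem_erase] at *
    tauto
  have c1 := Finset.card_le_card sub
  rw [card_of_mem_fc (injective_update hx i hv) (hV i) hi] at c1
  have c2 := Finset.card_insert_le v (((tri x).erase (x i)).erase (x j))
  rw [Finset.card_erase_of_mem (Finset.mem_erase.2
    ⟨fun h => hij (hx h).symm, mem_tri.2 ⟨j, rfl⟩⟩),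
    Finset.card_erase_of_mem (mem_tri.2 ⟨i, rfl⟩), card_tri hx] at c2
  omega

lemma ins_of_notMem {x : Fin 3 → ℕ} {T : LTree} {f : Finset ℕ} (n : ℕ) (hf : f ∉ fc x T) :
    ins f n x T = T := by
  induction T generalizing x with
  | leaf =>
    simp only [fc, Finset.mem_singleton] at hf
    rw [ins, if_neg (Ne.symm hf)]
  | node v t ih =>
    rw [mem_fc_node] at hf
    push Not at hf
    rw [ins]
    congr 1
    funext i
    exact ih i (hf i)

lemma lab_ins {x : Fin 3 → ℕ} {T : LTree} {f : Finset ℕ} (n : ℕ) (hf : f ∈ fc x T) :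
    (ins f n x T).lab = insert n T.lab := by
  induction T generalizing x with
  | leaf =>
    simp only [fc, Finset.mem_singleton] at hf
    rw [ins, if_pos hf.symm]
    ext; simp [lab]
  | node v t ih =>
    obtain ⟨i, hi⟩ := mem_fc_node.1 hf
    ext u
    rw [ins, mem_lab_node, Finset.mem_insert, mem_lab_node]
    have h : ∀ j, u ∈ (ins f n (Function.update x j v) (t j)).lab ↔
        u ∈ (t j).lab ∨ (u = n ∧ f ∈ fc (Function.update x j v) (t j)) := fun j => by
      by_cases hj : f ∈ fc (Function.update x j v) (t j)
      · rw [ih j hj, Finset.mem_insert]; tauto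
      · rw [ins_of_notMem n hj]; tauto
    simp only [h]
    constructor
    · rintro (h | ⟨j, h | h⟩)
      · exact Or.inr (Or.inl h)
      · exact Or.inr (Or.inr ⟨j, h⟩)
      · exact Or.inl h.1
    · rintro (h | h | ⟨j, h⟩)
      · exact Or.inr ⟨i, Or.inr ⟨h, hi⟩⟩
      · exact Or.inl h
      · exact Or.inr ⟨j, Or.inl h⟩

lemma lab_ins_subset (x : Fin 3 → ℕ) (T : LTree) (f : Finset ℕ) (n : ℕ) :
    (ins f n x T).lab ⊆ insert n T.lab := by
  by_cases hf : f ∈ fc x T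
  · rw [lab_ins n hf]
  · rw [ins_of_notMem n hf]; exact Finset.subset_insert _ _

lemma mem_fc_ins {x : Fin 3 → ℕ} {T : LTree} {f g : Finset ℕ} (n : ℕ) (hx : x.Injective)
    (hT : Valid x T) :
    g ∈ fc x (ins f n x T) ↔
      (g ∈ fc x T ∧ g ≠ f) ∨ (f ∈ fc x T ∧ g ∈ f.image fun u => insert n (f.erase u)) := by
  induction T generalizing x with
  | leaf =>
    rw [ins]
    split_ifs with h
    · subst h
      rw [mem_fc_node]
      simp only [fc, Finset.mem_singleton, tri_update hx, Finset.mem_image, mem_tri]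
      constructor
      · rintro ⟨i, rfl⟩
        exact Or.inr ⟨trivial, x i, ⟨i, rfl⟩, rfl⟩
      · rintro (⟨h, h'⟩ | ⟨-, _, ⟨i, rfl⟩, rfl⟩)
        · exact absurd h h'
        · exact ⟨i, rfl⟩
    · simp only [fc, Finset.mem_singleton]
      constructor
      · rintro rfl; exact Or.inl ⟨rfl, h⟩
      · rintro (⟨h, -⟩ | ⟨h', -⟩)
        · exact h
        · exact absurd h'.symm h
  | node v t ih =>
    rw [ins, mem_fc_node, mem_fc_node, mem_fc_node]
    simp only [fun i => ih i (injective_update hx i hT.1) (hT.2.1 i)]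
    constructor
    · rintro ⟨i, ⟨h, h'⟩ | ⟨h, h'⟩⟩
      · exact Or.inl ⟨⟨i, h⟩, h'⟩
      · exact Or.inr ⟨⟨i, h⟩, h'⟩
    · rintro (⟨⟨i, h⟩, h'⟩ | ⟨⟨i, h⟩, h'⟩)
      · exact ⟨i, Or.inl ⟨h, h'⟩⟩
      · exact ⟨i, Or.inr ⟨h, h'⟩⟩

lemma valid_ins {x : Fin 3 → ℕ} {T : LTree} {f : Finset ℕ} {n : ℕ} (hx : x.Injective)
    (hT : Valid x T) (hn : n ∉ tri x ∪ T.lab) : Valid x (ins f n x T) := by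
  induction T generalizing x with
  | leaf =>
    rw [ins]
    split_ifs
    · exact ⟨fun h => hn (Finset.mem_union_left _ h), fun _ => trivial,
        fun _ => Finset.disjoint_empty_left _, fun _ _ _ => Finset.disjoint_empty_left _⟩
    · trivial
  | node v t ih =>
    have hT' := hT
    obtain ⟨hv, hV, hd, hd2⟩ := hT
    simp only [Finset.mem_union, mem_lab_node, not_or, not_exists] at hn
    obtain ⟨hn1, hn2, hn3⟩ := hn
    have hn4 : n ∉ insert v (tri x) := by simp [hn1, hn2]
    refine ⟨hv, fun i => ih i (injective_update hx i hv) (hV i) ?_, fun i => ?_, fun i j hij => ?_⟩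
    · simp only [Finset.mem_union, not_or]
      exact ⟨fun h => hn4 (tri_update_subset x i v h), hn3 i⟩
    · exact Finset.disjoint_of_subset_left (lab_ins_subset _ _ _ _)
        (Finset.disjoint_insert_left.2 ⟨hn4, hd i⟩)
    · dsimp only
      by_cases hi : f ∈ fc (Function.update x i v) (t i)
      · rw [ins_of_notMem (T := t j) n fun hj => hij (eq_of_mem_fc_of_mem_fc hx hT' hi hj)]
        exact Finset.disjoint_of_subset_left (lab_ins_subset _ _ _ _)
          (Finset.disjoint_insert_left.2 ⟨hn3 j, hd2 i j hij⟩)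
      · rw [ins_of_notMem (T := t i) n hi]
        exact Finset.disjoint_of_subset_right (lab_ins_subset _ _ _ _)
          (Finset.disjoint_insert_right.2 ⟨hn3 i, hd2 i j hij⟩)

/-- The bridge between networks and trees: faces correspond to leaves, so summing over the face to
subdivide is `grow`. Choosing φ suitably also yields the size after a step and the number of faces.
-/
lemma sum_fc_shape_ins {x : Fin 3 → ℕ} {T : LTree} (n : ℕ) (hx : x.Injective)
    (hT : Valid x T) (φ : Tree → ℝ) :
    ∑ f ∈ fc x T, φ (ins f n x T).shape = T.shape.grow φ := by
  induction T generalizing x φ with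
  | leaf => simp [fc, ins, shape, Tree.grow]
  | node v t ih =>
    have hd : (↑(Finset.univ : Finset (Fin 3)) : Set (Fin 3)).PairwiseDisjoint
        fun i => fc (Function.update x i v) (t i) := fun i _ j _ hij =>
      Finset.disjoint_left.2 fun f hi hj => hij (eq_of_mem_fc_of_mem_fc hx hT hi hj)
    rw [fc, Finset.sum_biUnion hd, shape, Tree.grow]
    refine Finset.sum_congr rfl fun i _ => ?_
    rw [← ih i (injective_update hx i hT.1) (hT.2.1 i)]
    refine Finset.sum_congr rfl fun f hf => ?_
    rw [ins, shape]
    congr 2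
    funext j
    rcases eq_or_ne j i with rfl | hj
    · simp
    · rw [Function.update_of_ne hj,
        ins_of_notMem n fun h => hj (eq_of_mem_fc_of_mem_fc hx hT h hf)]

lemma size_shape_ins {x : Fin 3 → ℕ} {T : LTree} {f : Finset ℕ} (n : ℕ) (hx : x.Injective)
    (hT : Valid x T) (hf : f ∈ fc x T) : (ins f n x T).shape.size = T.shape.size + 1 := by
  by_contra h
  have h1 := sum_fc_shape_ins n hx hT fun S => if S.size = T.shape.size + 1 then 0 else 1
  rw [Tree.grow_congr (ψ := fun _ => 0) _ (fun S hS => by simp [hS]), Tree.grow_const,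
    mul_zero, Finset.sum_eq_zero_iff_of_nonneg fun _ _ => by split_ifs <;> simp] at h1
  simpa [h] using h1 f hf

lemma card_fc {x : Fin 3 → ℕ} {T : LTree} (hx : x.Injective) (hT : Valid x T) :
    (fc x T).card = 2 * T.shape.size + 1 := by
  have h := sum_fc_shape_ins 0 hx hT fun _ => 1
  rw [Tree.grow_one, Tree.leaves] at h
  simp only [Finset.sum_const, nsmul_eq_mul, mul_one] at h
  exact_mod_cast h

end LTree

/-- A walk can change between regions only at separating vertices. -/
lemma card_visited_le {κ : Type*} [Fintype κ] [DecidableEq κ] {G : SimpleGraph ℕ} {V : Finset ℕ}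
    {I : κ → Finset ℕ} (hV : ∀ c, Disjoint (I c) V) (hI : ∀ c d, c ≠ d → Disjoint (I c) (I d))
    (hG : ∀ c, ∀ u ∈ I c, ∀ w, G.Adj u w → w ∈ I c ∨ w ∈ V) (l : List ℕ)
    (hl : l.IsChain G.Adj) :
    (Finset.univ.filter fun c => ∃ u ∈ l, u ∈ I c).card ≤ (l.filter (· ∈ V)).length + 1 ∧
    ∀ a ∈ l.head?, a ∈ V →
      (Finset.univ.filter fun c => ∃ u ∈ l, u ∈ I c).card ≤ (l.filter (· ∈ V)).length := by
  -- The second claim, that the +1 is unnecessary when the walk starts in V, pays for a new region: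
  -- a walk leaving that region must next step into V.
  induction l with
  | nil => simp
  | cons a l ih =>
    have ih := ih hl.tail
    by_cases ha : a ∈ V
    · have e : (Finset.univ.filter fun c => ∃ u ∈ a :: l, u ∈ I c) =
          Finset.univ.filter fun c => ∃ u ∈ l, u ∈ I c := by
        ext c
        have := Finset.disjoint_right.1 (hV c) ha
        simp [this]
      rw [e, List.filter_cons_of_pos (by simpa using ha), List.length_cons]
      exact ⟨by omega, fun _ _ _ => ih.1⟩
    · rw [List.filter_cons_of_neg (by simpa using ha)]
      refine ⟨?_, fun b hb hb' => by simp at hb; exact absurd (hb ▸ hb') ha⟩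
      by_cases hc : ∃ c, a ∈ I c
      · obtain ⟨c, hc⟩ := hc
        have sub : (Finset.univ.filter fun d => ∃ u ∈ a :: l, u ∈ I d) ⊆
            insert c (Finset.univ.filter fun d => ∃ u ∈ l, u ∈ I d) := by
          intro d hd
          simp only [Finset.mem_filter, Finset.mem_univ, true_and, Finset.mem_insert,
            List.mem_cons, exists_eq_or_imp] at hd ⊢
          rcases hd with hd | hd
          · left
            by_contra hcd
            exact Finset.disjoint_left.1 (hI d c hcd) hd hc
          · exact Or.inr hd
        cases l with
        | nil =>
          refine (Finset.card_le_card sub).trans ?_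
          simp
        | cons b l =>
          rw [List.isChain_cons_cons] at hl
          rcases hG c a hc b hl.1 with hb | hb
          · rw [Finset.insert_eq_of_mem (by simp [hb])] at sub
            exact (Finset.card_le_card sub).trans ih.1
          · refine (Finset.card_le_card sub).trans ((Finset.card_insert_le _ _).trans ?_)
            exact Nat.add_le_add_right (ih.2 b (by simp) hb) 1
      · have e : (Finset.univ.filter fun c => ∃ u ∈ a :: l, u ∈ I c) =
            Finset.univ.filter fun c => ∃ u ∈ l, u ∈ I c := by
          ext c
          have := not_exists.1 hc c
          simp [this]
        rw [e]
        exact ih.1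

/-! ### Paths inside a subdivided triangle -/

namespace LTree

/-- Inside the triangle `x`, the edges of `G` are sides of faces. -/
def Local (G : SimpleGraph ℕ) (x : Fin 3 → ℕ) (T : LTree) : Prop :=
  ∀ u ∈ T.lab, ∀ w, G.Adj u w → ∃ f ∈ fc x T, u ∈ f ∧ w ∈ f

lemma Local.child {G : SimpleGraph ℕ} {x : Fin 3 → ℕ} {v : ℕ} {t : Fin 3 → LTree}
    (h : Local G x (node v t)) (hT : Valid x (node v t)) (i : Fin 3) :
    Local G (Function.update x i v) (t i) := by
  intro u hu w hw
  obtain ⟨f, hf, huf, hwf⟩ := h u (mem_lab_node.2 (Or.inr ⟨i, hu⟩)) w hw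
  obtain ⟨j, hj⟩ := mem_fc_node.1 hf
  rcases eq_or_ne j i with rfl | hij
  · exact ⟨f, hj, huf, hwf⟩
  · rcases Finset.mem_union.1 (fc_subset hj huf) with h' | h'
    · exact absurd (tri_update_subset x j v h') (Finset.disjoint_left.1 (hT.2.2.1 i) hu)
    · exact absurd h' (Finset.disjoint_left.1 (hT.2.2.2 i j hij.symm) hu)

/-- A path misses one of the nine triangles of the second subdivision. -/
lemma exists_disjoint_lab {G : SimpleGraph ℕ} {x : Fin 3 → ℕ} {v : ℕ} {w : Fin 3 → ℕ}
    {r : Fin 3 → Fin 3 → LTree} (hT : Valid x (node v fun i => node (w i) (r i)))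
    (hG : Local G x (node v fun i => node (w i) (r i))) {l : List ℕ} (hl : l.IsChain G.Adj)
    (hl' : l.Nodup) : ∃ c : Fin 3 × Fin 3, l.toFinset ∩ (r c.1 c.2).lab = ∅ := by
  set V : Finset ℕ := insert v (tri x) ∪ Finset.univ.image w with hVdef
  have hVcard : V.card ≤ 7 := by
    refine (Finset.card_union_le _ _).trans ?_
    have h1 := Finset.card_insert_le v (tri x)
    have h2 : (tri x).card ≤ 3 := Finset.card_image_le
    have h3 : (Finset.univ.image w).card ≤ 3 := Finset.card_image_le
    omega
  have hsub : ∀ i j, (r i j).lab ⊆ (node (w i) (r i)).lab := fun i j u hu =>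
    mem_lab_node.2 (Or.inr ⟨j, hu⟩)
  have hwl : ∀ i, w i ∈ (node (w i) (r i)).lab := fun i => mem_lab_node.2 (Or.inl rfl)
  have hV2 := hT.2.1
  have hdis := hT.2.2.2
  have key := card_visited_le (κ := Fin 3 × Fin 3) (G := G) (V := V)
    (I := fun c => (r c.1 c.2).lab) ?_ ?_ ?_ l hl
  · by_contra! hne
    have hu : (Finset.univ.filter fun c : Fin 3 × Fin 3 => ∃ u ∈ l, u ∈ (r c.1 c.2).lab) =
        Finset.univ := by
      refine Finset.filter_true_of_mem fun c _ => ?_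
      obtain ⟨u, hu⟩ := hne c
      rw [Finset.mem_inter, List.mem_toFinset] at hu
      exact ⟨u, hu⟩
    -- If all nine regions were visited, then 9 ≤ 7 + 1, since a path meets each of the at most
    -- seven separating vertices once.
    have h1 := key.1
    rw [hu] at h1
    have h2 : (l.filter (· ∈ V)).length ≤ V.card := by
      rw [← List.toFinset_card_of_nodup (hl'.filter _)]
      exact Finset.card_le_card fun u hu => by
        simp only [List.mem_toFinset, List.mem_filter, decide_eq_true_eq] at hu
        exact hu.2
    simp only [Finset.card_univ, Fintype.card_prod, Fintype.card_fin] at h1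
    omega
  · rintro ⟨i, j⟩
    refine Finset.disjoint_union_right.2
      ⟨Finset.disjoint_of_subset_left (hsub i j) (hT.2.2.1 i), ?_⟩
    refine Finset.disjoint_right.2 fun u hu hu' => ?_
    obtain ⟨k, -, rfl⟩ := Finset.mem_image.1 hu
    rcases eq_or_ne k i with rfl | hk
    · exact Finset.disjoint_left.1 ((hV2 k).2.2.1 j) hu' (Finset.mem_insert_self _ _)
    · exact Finset.disjoint_left.1 (hdis k i hk) (hwl k) (hsub i j hu')
  · rintro ⟨i, j⟩ ⟨i', j'⟩ h
    rcases eq_or_ne i i' with rfl | hi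
    · exact (hV2 i).2.2.2 j j' fun h' => h (by rw [h'])
    · exact Finset.disjoint_of_subset_left (hsub i j)
        (Finset.disjoint_of_subset_right (hsub i' j') (hdis i i' hi))
  · rintro ⟨i, j⟩ u hu y hy
    obtain ⟨f, hf, -, hyf⟩ := ((hG.child hT i).child (hV2 i) j) u hu y hy
    rcases Finset.mem_union.1 (fc_subset hf hyf) with h | h
    · right
      rcases Finset.mem_insert.1 (tri_update_subset _ _ _ h) with rfl | h
      · exact Finset.mem_union_right _ (Finset.mem_image_of_mem _ (Finset.mem_univ i))
      · exact Finset.mem_union_left _ (tri_update_subset _ _ _ h)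
    · exact Or.inl h

lemma card_inter_lab_node_le (S : Finset ℕ) (v : ℕ) (t : Fin 3 → LTree) :
    (S ∩ (node v t).lab).card ≤ 1 + ∑ i, (S ∩ (t i).lab).card := by
  have : S ∩ (node v t).lab ⊆ insert v (Finset.univ.biUnion fun i => S ∩ (t i).lab) := by
    intro u hu
    rw [Finset.mem_inter, mem_lab_node] at hu
    simp only [Finset.mem_insert, Finset.mem_biUnion, Finset.mem_univ, true_and,
      Finset.mem_inter]
    rcases hu with ⟨h, rfl | ⟨i, hi⟩⟩
    · exact Or.inl rfl
    · exact Or.inr ⟨i, h, hi⟩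
  refine (Finset.card_le_card this).trans ((Finset.card_insert_le _ _).trans ?_)
  rw [add_comm]
  exact Nat.add_le_add_left Finset.card_biUnion_le 1

/-- The number of inner vertices on a path is at most `pathBound`. -/
theorem card_inter_lab_le {G : SimpleGraph ℕ} {l : List ℕ} (hl : l.IsChain G.Adj)
    (hl' : l.Nodup) (T : LTree) {x : Fin 3 → ℕ} (hT : Valid x T)
    (hG : Local G x T) : (l.toFinset ∩ T.lab).card ≤ T.shape.pathBound := by
  let C (T : LTree) : Prop := ∀ x : Fin 3 → ℕ, Valid x T → Local G x T →
    (l.toFinset ∩ T.lab).card ≤ T.shape.pathBound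
  -- The claim is carried for a tree and its children together, so that the induction hypothesis
  -- reaches depth two.
  suffices h : C T ∧ ∀ v r, T = node v r → ∀ j, C (r j) from h.1 x hT hG
  clear hT hG x
  induction T with
  | leaf => exact ⟨fun x _ _ => by simp [lab], fun v r h => by simp at h⟩
  | node v t ih =>
    refine ⟨fun x hT hG => ?_, fun v' r h j => by
      obtain ⟨-, rfl⟩ := LTree.node.inj h; exact (ih j).1⟩
    have h1 : ∀ i, (l.toFinset ∩ (t i).lab).card ≤ (t i).shape.pathBound := fun i =>
      (ih i).1 _ (hT.2.1 i) (hG.child hT i)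
    have h0 := card_inter_lab_node_le l.toFinset v t
    refine Tree.le_pathBound_node (h0.trans ?_) fun s hs => ?_
    · exact Nat.add_le_add_left (Finset.sum_le_sum fun i _ => h1 i) 1
    · have hs' : ∀ i, (t i).shape = .node fun j => s (i, j) := fun i =>
        congrFun (Tree.node.inj hs) i
      have : ∀ i, ∃ w r, t i = node w r := fun i => by
        rcases hi : t i with _ | ⟨w, r⟩
        · have := hs' i
          rw [hi] at this
          simp [shape] at this
        · exact ⟨w, r, rfl⟩
      choose w r hr using this
      obtain rfl : t = fun i => node (w i) (r i) := funext hr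
      have hsr : ∀ i j, (r i j).shape = s (i, j) := fun i j =>
        congrFun (Tree.node.inj (hs' i)) j
      obtain ⟨c, hc⟩ := exists_disjoint_lab hT hG hl hl'
      refine ⟨c, ?_⟩
      have h2 : ∀ p : Fin 3 × Fin 3, (l.toFinset ∩ (r p.1 p.2).lab).card ≤ (s p).pathBound :=
        fun p => by
          have := (ih p.1).2 (w p.1) (r p.1) rfl p.2 _ ((hT.2.1 p.1).2.1 p.2)
            ((hG.child hT p.1).child (hT.2.1 p.1) p.2)
          rwa [hsr] at this
      -- The constant 4 counts the centre v and the three second centres `w i`.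
      have h3 := Finset.sum_le_sum fun (i : Fin 3) (_ : i ∈ Finset.univ) =>
        card_inter_lab_node_le l.toFinset (w i) (r i)
      rw [Finset.sum_add_distrib, ← Fintype.sum_prod_type'
        (f := fun i j => (l.toFinset ∩ (r i j).lab).card),
        ← Finset.add_sum_erase _ _ (Finset.mem_univ c), hc] at h3
      have h4 := Finset.sum_le_sum fun (p : Fin 3 × Fin 3) (_ : p ∈ Finset.univ.erase c) => h2 p
      simp only [Finset.sum_const, Finset.card_univ, Fintype.card_fin, Finset.card_empty] at h3
      refine h0.trans ?_
      norm_num at h3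
      dsimp only
      omega

end LTree

/-! ### Histories of the random process -/

/-- The list of the first `n` choices, the latest first. -/
def hist (F : ℕ → Finset ℕ) : ℕ → List (Finset ℕ)
  | 0 => []
  | n + 1 => F n :: hist F n

/-- The network produced by a list of choices. -/
def netOf : List (Finset ℕ) → Network
  | [] => Network.triangle
  | f :: h => (netOf h).subdivide f

/-- The labelled tree that records a list of choices. -/
def treeOf : List (Finset ℕ) → LTree
  | [] => .leaf
  | f :: h => LTree.ins f (netOf h).order Fin.val (treeOf h)

lemma network_eq_netOf (F : ℕ → Finset ℕ) (n : ℕ) : network F n = netOf (hist F n) := by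
  induction n with
  | zero => rfl
  | succ n ih => rw [network, hist, netOf, ih]

lemma hist_eq_hist_iff {F G : ℕ → Finset ℕ} {n : ℕ} :
    hist F n = hist G n ↔ ∀ i < n, F i = G i := by
  induction n with
  | zero => simp [hist]
  | succ n ih => simp only [hist, List.cons.injEq, ih, Nat.forall_lt_succ_right, and_comm]

lemma exists_hist_eq (h : List (Finset ℕ)) : ∃ F, hist F h.length = h := by
  induction h with
  | nil => exact ⟨fun _ => ∅, rfl⟩
  | cons f h ih =>
    obtain ⟨F, hF⟩ := ih
    refine ⟨Function.update F h.length f, ?_⟩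
    rw [List.length_cons, hist, Function.update_self]
    congr 1
    refine Eq.trans (hist_eq_hist_iff.2 fun i hi => ?_) hF
    exact Function.update_of_ne hi.ne _ _

/-- The possible histories of length `n`. -/
def validHist : ℕ → Finset (List (Finset ℕ))
  | 0 => {[]}
  | n + 1 => (validHist n).biUnion fun h => (netOf h).faces.image fun f => f :: h

lemma mem_validHist_succ {n : ℕ} {h : List (Finset ℕ)} :
    h ∈ validHist (n + 1) ↔ ∃ h' ∈ validHist n, ∃ f ∈ (netOf h').faces, f :: h' = h := by
  simp [validHist]

lemma length_of_mem_validHist {n : ℕ} {h : List (Finset ℕ)} (hh : h ∈ validHist n) :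
    h.length = n := by
  induction n generalizing h with
  | zero => simp [validHist] at hh; simp [hh]
  | succ n ih =>
    obtain ⟨h', hh', f, -, rfl⟩ := mem_validHist_succ.1 hh
    simp [ih hh']

/-- The network `N` with `n + 3` vertices is described by the labelled tree `T`. -/
structure Describes (n : ℕ) (N : Network) (T : LTree) : Prop where
  order : N.order = n + 3
  faces : N.faces = LTree.fc Fin.val T
  valid : LTree.Valid Fin.val T
  vertices : tri Fin.val ∪ T.lab = Finset.range (n + 3)
  size : T.shape.size = n
  adj : ∀ u w, N.graph.Adj u w → ∃ f ∈ N.faces, u ∈ f ∧ w ∈ f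

lemma Describes.triangle : Describes 0 Network.triangle .leaf where
  order := rfl
  faces := rfl
  valid := trivial
  vertices := rfl
  size := rfl
  adj u w h := by
    refine ⟨{0, 1, 2}, by simp [Network.triangle], ?_⟩
    simp only [Network.triangle, SimpleGraph.fromRel_adj] at h
    simp only [Finset.mem_insert, Finset.mem_singleton]
    omega

lemma Describes.subdivide {n : ℕ} {N : Network} {T : LTree} (h : Describes n N T) {f : Finset ℕ}
    (hf : f ∈ N.faces) :
    Describes (n + 1) (N.subdivide f) (LTree.ins f N.order Fin.val T) := by
  have hx : Function.Injective (Fin.val : Fin 3 → ℕ) := Fin.val_injective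
  have hf' := hf
  rw [h.faces] at hf'
  have hn : N.order ∉ tri Fin.val ∪ T.lab := by rw [h.vertices, h.order]; simp
  have hfaces : ∀ g, g ∈ (N.subdivide f).faces ↔
      (g ∈ N.faces ∧ g ≠ f) ∨ g ∈ f.image fun u => insert N.order (f.erase u) := fun g => by
    simp only [Network.subdivide, Finset.mem_union, Finset.mem_erase]
    tauto
  have hnew : ∀ u w, u = N.order → w ∈ f →
      ∃ g ∈ (N.subdivide f).faces, u ∈ g ∧ w ∈ g := by
    rintro u w rfl hw
    have hc := LTree.card_of_mem_fc hx h.valid hf'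
    obtain ⟨y, hy, hyw⟩ := Finset.exists_mem_ne (by omega : 1 < f.card) w
    refine ⟨insert N.order (f.erase y), (hfaces _).2 (Or.inr (Finset.mem_image_of_mem _ hy)),
      Finset.mem_insert_self _ _, Finset.mem_insert_of_mem (Finset.mem_erase.2 ⟨hyw.symm, hw⟩)⟩
  refine ⟨by simp [Network.subdivide, h.order], ?_, LTree.valid_ins hx h.valid hn, ?_,
    by rw [LTree.size_shape_ins _ hx h.valid hf', h.size], fun u w huw => ?_⟩
  · ext g
    rw [hfaces, LTree.mem_fc_ins _ hx h.valid, h.faces]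
    simp [hf']
  · rw [LTree.lab_ins _ hf', Finset.union_insert, h.vertices, h.order]
    exact Finset.range_add_one.symm
  · simp only [Network.subdivide, SimpleGraph.sup_adj, SimpleGraph.fromRel_adj] at huw
    rcases huw with huw | ⟨-, ⟨h1, h2⟩ | ⟨h1, h2⟩⟩
    · obtain ⟨g, hg, hu, hw⟩ := h.adj u w huw
      rcases eq_or_ne g f with rfl | hgf
      · have hc := LTree.card_of_mem_fc hx h.valid hf'
        -- An edge of the subdivided face survives in the new face that omits the third vertex.
        have : ∃ y ∈ g, y ∉ ({u, w} : Finset ℕ) := by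
          by_contra! h'
          have := (Finset.card_le_card h').trans Finset.card_le_two
          omega
        obtain ⟨y, hy, hy'⟩ := this
        simp only [Finset.mem_insert, Finset.mem_singleton, not_or] at hy'
        exact ⟨insert N.order (g.erase y), (hfaces _).2 (Or.inr (Finset.mem_image_of_mem _ hy)),
          Finset.mem_insert_of_mem (Finset.mem_erase.2 ⟨Ne.symm hy'.1, hu⟩),
          Finset.mem_insert_of_mem (Finset.mem_erase.2 ⟨Ne.symm hy'.2, hw⟩)⟩
      · exact ⟨g, (hfaces g).2 (Or.inl ⟨hg, hgf⟩), hu, hw⟩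
    · exact hnew u w h1 h2
    · obtain ⟨g, hg, h3, h4⟩ := hnew w u h1 h2
      exact ⟨g, hg, h4, h3⟩

lemma describes_of_mem_validHist {n : ℕ} {h : List (Finset ℕ)} (hh : h ∈ validHist n) :
    Describes n (netOf h) (treeOf h) := by
  induction n generalizing h with
  | zero => simp [validHist] at hh; subst hh; exact Describes.triangle
  | succ n ih =>
    obtain ⟨h', hh', f, hf, rfl⟩ := mem_validHist_succ.1 hh
    exact (ih hh').subdivide hf

lemma card_faces_of_mem_validHist {n : ℕ} {h : List (Finset ℕ)} (hh : h ∈ validHist n) :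
    (netOf h).faces.card = 2 * n + 1 := by
  have hd := describes_of_mem_validHist hh
  rw [hd.faces, LTree.card_fc Fin.val_injective hd.valid, hd.size]

lemma sum_validHist (n : ℕ) (φ : Tree → ℝ) :
    ∑ h ∈ validHist n, φ (treeOf h).shape = Tree.total n φ := by
  induction n generalizing φ with
  | zero => simp [validHist, treeOf, Tree.total, LTree.shape]
  | succ n ih =>
    rw [validHist, Finset.sum_biUnion, Tree.total, ← ih]
    · refine Finset.sum_congr rfl fun h hh => ?_
      have hd := describes_of_mem_validHist hh
      rw [Finset.sum_image fun f _ g _ hfg => (List.cons.inj hfg).1, hd.faces,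
        ← LTree.sum_fc_shape_ins (netOf h).order Fin.val_injective hd.valid]
      rfl
    · intro h _ h' _ hne
      refine Finset.disjoint_left.2 fun g hg hg' => hne ?_
      obtain ⟨f, -, rfl⟩ := Finset.mem_image.1 hg
      obtain ⟨f', -, h2⟩ := Finset.mem_image.1 hg'
      exact (List.cons.inj h2).2.symm

lemma card_validHist (n : ℕ) : ((validHist n).card : ℝ) = Tree.histories n := by
  have := sum_validHist n fun _ => 1
  have h2 := Tree.total_size n fun _ => 1
  simp only [Finset.sum_const, nsmul_eq_mul, mul_one] at *
  rw [this, h2]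

/-- The number of vertices on a path in a network with a valid history. -/
lemma length_le_of_isChain {n : ℕ} {h : List (Finset ℕ)} (hh : h ∈ validHist n) {l : List ℕ}
    (hl : l.IsChain (netOf h).graph.Adj) (hl' : l.Nodup) (hlt : ∀ u ∈ l, u < n + 3) :
    l.length ≤ 3 + (treeOf h).shape.pathBound := by
  have hd := describes_of_mem_validHist hh
  have hloc : LTree.Local (netOf h).graph Fin.val (treeOf h) := fun u _ w huw => by
    rw [← hd.faces]; exact hd.adj u w huw
  have h1 := LTree.card_inter_lab_le hl hl' _ hd.valid hloc
  rw [← List.toFinset_card_of_nodup hl']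
  have h2 : l.toFinset ⊆ tri Fin.val ∪ (l.toFinset ∩ (treeOf h).lab) := by
    intro u hu
    have h3 : u ∈ tri Fin.val ∪ (treeOf h).lab := by
      rw [hd.vertices]; exact Finset.mem_range.2 (hlt u (List.mem_toFinset.1 hu))
    simp only [Finset.mem_union, Finset.mem_inter] at *
    tauto
  refine (Finset.card_le_card h2).trans ((Finset.card_union_le _ _).trans ?_)
  rw [card_tri Fin.val_injective]
  omega

lemma order_network (F : ℕ → Finset ℕ) (n : ℕ) : (network F n).order = n + 3 := by
  induction n with
  | zero => rfl
  | succ n ih => simp [network, Network.subdivide, ih]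

lemma monotone_graph_network (F : ℕ → Finset ℕ) : Monotone fun n => (network F n).graph :=
  monotone_nat_of_le_succ fun n => by
    simp only [network, Network.subdivide]; exact le_sup_left

/-! ### The law of the history and the almost sure bound -/

section RandomNetwork

variable {Ω : Type*} [MeasurableSpace Ω] {P : Measure Ω} {F : ℕ → Ω → Finset ℕ}

lemma IsUniformSubdivision.measurableSet_hist (hF : IsUniformSubdivision P F) (n : ℕ)
    (h : List (Finset ℕ)) : MeasurableSet {ω | hist (fun i => F i ω) n = h} := by
  induction n generalizing h with
  | zero => simp [hist]
  | succ n ih =>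
    cases h with
    | nil => simp [hist]
    | cons f h =>
      simp only [hist, List.cons.injEq, Set.ofPred_and]
      exact (hF.measurable n f).inter (ih h)

/-- All networks after n steps have 2n + 1 faces, so all valid histories of a given length are
equally likely. -/
lemma IsUniformSubdivision.measure_hist [IsProbabilityMeasure P]
    (hF : IsUniformSubdivision P F) {n : ℕ} {h : List (Finset ℕ)} (hh : h ∈ validHist n) :
    P {ω | hist (fun i => F i ω) n = h} = ENNReal.ofReal (1 / Tree.histories n) := by
  induction n generalizing h with
  | zero => simp [validHist] at hh; simp [hh, hist, Tree.histories]
  | succ n ih =>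
    obtain ⟨h', hh', f, hf, rfl⟩ := mem_validHist_succ.1 hh
    obtain ⟨G, hG⟩ := exists_hist_eq h'
    rw [length_of_mem_validHist hh'] at hG
    have e : {ω | hist (fun i => F i ω) (n + 1) = f :: h'} =
        {ω | (∀ i < n, F i ω = G i) ∧ F n ω = f} := by
      ext ω
      simp only [hist, List.cons.injEq, Set.mem_ofPred_eq]
      rw [← hG, hist_eq_hist_iff, and_comm]
    have e2 : {ω | ∀ i < n, F i ω = G i} = {ω | hist (fun i => F i ω) n = h'} := by
      ext ω
      simp only [Set.mem_ofPred_eq]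
      rw [← hG, hist_eq_hist_iff]
    have hnet : network G n = netOf h' := by rw [network_eq_netOf, hG]
    rw [e, hF.uniform n G f (by rwa [hnet]), e2, ih hh', hnet, card_faces_of_mem_validHist hh',
      Tree.histories_succ, ← div_div, ENNReal.ofReal_div_of_pos (y := 2 * (n : ℝ) + 1)
        (by positivity)]
    congr 1
    rw [show (2 * (n : ℝ) + 1) = ((2 * n + 1 : ℕ) : ℝ) by push_cast; ring, ENNReal.ofReal_natCast]

lemma IsUniformSubdivision.ae_mem_validHist [IsProbabilityMeasure P]
    (hF : IsUniformSubdivision P F) (n : ℕ) :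
    ∀ᵐ ω ∂P, hist (fun i => F i ω) n ∈ validHist n := by
  have e : {ω | hist (fun i => F i ω) n ∈ validHist n} =
      ⋃ h ∈ validHist n, {ω | hist (fun i => F i ω) n = h} := by
    ext ω; simp
  have hm : MeasurableSet {ω | hist (fun i => F i ω) n ∈ validHist n} := by
    rw [e]; exact Finset.measurableSet_biUnion _ fun h _ => hF.measurableSet_hist n h
  refine (mem_ae_iff_prob_eq_one hm).2 ?_
  rw [e,
    measure_biUnion_finset _ fun h _ => hF.measurableSet_hist n h]
  · rw [Finset.sum_congr rfl fun h hh => hF.measure_hist hh, Finset.sum_const, nsmul_eq_mul,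
      ← ENNReal.ofReal_natCast, ← ENNReal.ofReal_mul (Nat.cast_nonneg _), card_validHist,
      mul_one_div_cancel (Tree.histories_pos n).ne', ENNReal.ofReal_one]
  · intro h _ h' _ hne
    exact Set.disjoint_left.2 fun ω h1 h2 => hne (h1.symm.trans h2)

lemma IsUniformSubdivision.measure_le_pathBound [IsProbabilityMeasure P]
    (hF : IsUniformSubdivision P F) (n : ℕ) {a : ℝ} (ha : 0 < a) :
    P {ω | a ≤ (treeOf (hist (fun i => F i ω) n)).shape.pathBound} ≤
      ENNReal.ofReal (Tree.rate n / a) := by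
  classical
  set B := (validHist n).filter fun h => a ≤ (treeOf h).shape.pathBound with hB
  have h1 : P {ω | a ≤ (treeOf (hist (fun i => F i ω) n)).shape.pathBound} ≤
      P (⋃ h ∈ B, {ω | hist (fun i => F i ω) n = h}) := by
    refine measure_mono_ae ?_
    filter_upwards [hF.ae_mem_validHist n] with ω hω h
    exact Set.mem_biUnion (Finset.mem_filter.2 ⟨hω, h⟩) rfl
  refine h1.trans ((measure_biUnion_finset_le _ _).trans ?_)
  rw [Finset.sum_congr rfl fun h hh => hF.measure_hist (Finset.mem_filter.1 hh).1,
    Finset.sum_const, nsmul_eq_mul, ← ENNReal.ofReal_natCast,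
    ← ENNReal.ofReal_mul (Nat.cast_nonneg _)]
  refine ENNReal.ofReal_le_ofReal ?_
  have h2 : (B.card : ℝ) * a ≤ Tree.total n fun T => (T.pathBound : ℝ) := by
    rw [← sum_validHist n, ← nsmul_eq_mul]
    exact (Finset.card_nsmul_le_sum B _ a fun h hh => (Finset.mem_filter.1 hh).2).trans
      (Finset.sum_le_sum_of_subset_of_nonneg (Finset.filter_subset _ _)
        fun _ _ _ => Nat.cast_nonneg _)
  have h3 := Tree.dropping_pathBound.mean_le n
  have hp := Tree.histories_pos n
  rw [Tree.mean, div_le_iff₀ hp] at h3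
  rw [mul_one_div, div_le_div_iff₀ hp ha]
  exact h2.trans h3

/-- The exponent 1 - 4.5·10⁻⁸ lies halfway between the rate's 1 - 5·10⁻⁸ and the target 1 - 4·10⁻⁸.
One half of the gap makes the Markov bounds summable, the other absorbs the constants in passing
from 2^j to t. -/
lemma rate_two_pow_div_le (j : ℕ) :
    Tree.rate (2 ^ j) / ((2 : ℝ) ^ j) ^ (1 - 45 / 10 ^ 9 : ℝ) ≤
      3 * 10 ^ 8 * ((2 : ℝ) ^ (-(5 / 10 ^ 9) : ℝ)) ^ j := by
  have h2 : (0 : ℝ) < 2 ^ j := by positivity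
  have h1 : (1 : ℝ) ≤ 2 ^ j := one_le_pow₀ (by norm_num)
  have e : ((2 : ℝ) ^ (-(5 / 10 ^ 9) : ℝ)) ^ j = ((2 : ℝ) ^ j) ^ (-(5 / 10 ^ 9) : ℝ) := by
    rw [← Real.rpow_natCast (2 : ℝ) j, ← Real.rpow_mul (by norm_num), mul_comm,
      Real.rpow_mul (by norm_num), Real.rpow_natCast]
  rw [e, div_le_iff₀ (Real.rpow_pos_of_pos h2 _), mul_assoc, ← Real.rpow_add h2, Tree.rate]
  have h3 : (2 * ((2 ^ j : ℕ) : ℝ) + 1) ^ (1 - Tree.eta) ≤ (3 * 2 ^ j) ^ (1 - Tree.eta) := by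
    refine Real.rpow_le_rpow (by positivity) ?_ (by norm_num [Tree.eta])
    push_cast; linarith
  rw [Real.mul_rpow (by norm_num) h2.le] at h3
  have h4 : (3 : ℝ) ^ (1 - Tree.eta) ≤ 3 ^ (1 : ℝ) :=
    Real.rpow_le_rpow_of_exponent_le (by norm_num) (by norm_num [Tree.eta])
  rw [Real.rpow_one] at h4
  have h5 := mul_le_mul_of_nonneg_right h4 (Real.rpow_nonneg h2.le (1 - Tree.eta))
  rw [show (-(5 / 10 ^ 9) + (1 - 45 / 10 ^ 9) : ℝ) = 1 - Tree.eta by norm_num [Tree.eta]]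
  linarith

lemma IsUniformSubdivision.ae_eventually_pathBound_lt [IsProbabilityMeasure P]
    (hF : IsUniformSubdivision P F) :
    ∀ᵐ ω ∂P, ∀ᶠ j : ℕ in atTop,
      ((treeOf (hist (fun i => F i ω) (2 ^ j))).shape.pathBound : ℝ) <
        ((2 : ℝ) ^ j) ^ (1 - 45 / 10 ^ 9 : ℝ) := by
  have hs : ∑' j : ℕ, P {ω | ((2 : ℝ) ^ j) ^ (1 - 45 / 10 ^ 9 : ℝ) ≤
      (treeOf (hist (fun i => F i ω) (2 ^ j))).shape.pathBound} ≠ ∞ := by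
    have hg : Summable fun j : ℕ => 3 * 10 ^ 8 * ((2 : ℝ) ^ (-(5 / 10 ^ 9) : ℝ)) ^ j :=
      (summable_geometric_of_lt_one (by positivity)
        (Real.rpow_lt_one_of_one_lt_of_neg (by norm_num) (by norm_num))).mul_left _
    refine ne_top_of_le_ne_top hg.tsum_ofReal_ne_top (ENNReal.tsum_le_tsum fun j => ?_)
    exact (hF.measure_le_pathBound (2 ^ j) (by positivity)).trans
      (ENNReal.ofReal_le_ofReal (rate_two_pow_div_le j))
  filter_upwards [ae_eventually_notMem hs] with ω hω
  filter_upwards [hω] with j hj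
  simpa using hj

lemma eventually_rpow_le :
    ∀ᶠ t : ℕ in atTop, 3 + (2 * (t : ℝ)) ^ (1 - 45 / 10 ^ 9 : ℝ) ≤
      (t : ℝ) ^ (1 - 4 * 10 ^ (-8 : ℤ) : ℝ) := by
  have h := (tendsto_rpow_atTop (by norm_num : (0 : ℝ) < 5 / 10 ^ 9)).comp
    tendsto_natCast_atTop_atTop
  filter_upwards [h.eventually_ge_atTop 5, eventually_ge_atTop 1] with t ht ht1
  have h1 : (1 : ℝ) ≤ t := by exact_mod_cast ht1
  have h0 : (0 : ℝ) < t := by linarith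
  have e : (t : ℝ) ^ (1 - 4 * 10 ^ (-8 : ℤ) : ℝ) =
      (t : ℝ) ^ (1 - 45 / 10 ^ 9 : ℝ) * (t : ℝ) ^ (5 / 10 ^ 9 : ℝ) := by
    rw [← Real.rpow_add h0]; norm_num
  have h2 : (1 : ℝ) ≤ (t : ℝ) ^ (1 - 45 / 10 ^ 9 : ℝ) := Real.one_le_rpow h1 (by norm_num)
  have h3 : (2 : ℝ) ^ (1 - 45 / 10 ^ 9 : ℝ) ≤ 2 ^ (1 : ℝ) :=
    Real.rpow_le_rpow_of_exponent_le (by norm_num) (by norm_num)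
  rw [Real.rpow_one] at h3
  simp only [Function.comp_apply] at ht
  rw [e, Real.mul_rpow (by norm_num) h0.le]
  have h4 := mul_le_mul_of_nonneg_left ht (zero_le_one.trans h2)
  have h5 := mul_le_mul_of_nonneg_right h3 (zero_le_one.trans h2)
  linarith

/-- Almost surely, all paths in a random Apollonian network are eventually short. -/
theorem IsUniformSubdivision.ae_eventually_path_lt [IsProbabilityMeasure P]
    (hF : IsUniformSubdivision P F) :
    ∀ᵐ ω ∂P, ∀ᶠ t : ℕ in atTop, ∀ u v, ∀ p : (RAN F t ω).Walk u v, p.IsPath →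
      (p.support.length : ℝ) < (t : ℝ) ^ (1 - 4 * 10 ^ (-8 : ℤ) : ℝ) := by
  filter_upwards [hF.ae_eventually_pathBound_lt, ae_all_iff.2 hF.ae_mem_validHist] with ω h1 h2
  obtain ⟨J, hJ⟩ := eventually_atTop.1 h1
  filter_upwards [eventually_rpow_le, eventually_ge_atTop (2 ^ J)] with t ht htJ u v p hp
  have ht0 : t ≠ 0 := by have := Nat.two_pow_pos J; omega
  -- Then t < 2^j ≤ 2t, and a path at time t is still a path at time 2^j, as edges are never
  -- removed.
  set j := Nat.log 2 t + 1 with hj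
  have htj : t < 2 ^ j := Nat.lt_pow_succ_log_self (by norm_num) t
  have hjt : 2 ^ j ≤ 2 * t := by
    have := Nat.pow_log_le_self 2 ht0
    rw [hj, pow_succ]; omega
  have hJj : J ≤ j := ((Nat.pow_lt_pow_iff_right (by norm_num)).1 (htJ.trans_lt htj)).le
  have hlen : (p.support.map Fin.val).length ≤
      3 + (treeOf (hist (fun i => F i ω) (2 ^ j))).shape.pathBound := by
    refine length_le_of_isChain (h2 (2 ^ j)) ?_ (hp.support_nodup.map Fin.val_injective) ?_
    · rw [List.isChain_map]
      refine p.isChain_adj_support.imp fun a b hab => ?_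
      rw [← network_eq_netOf]
      exact monotone_graph_network (fun i => F i ω) htj.le hab
    · intro a ha
      obtain ⟨b, -, rfl⟩ := List.mem_map.1 ha
      exact (b.2.trans_eq (order_network _ t)).trans (Nat.add_lt_add_right htj 3)
  rw [List.length_map] at hlen
  have h3 := hJ j hJj
  have h4 : ((2 : ℝ) ^ j) ^ (1 - 45 / 10 ^ 9 : ℝ) ≤ (2 * (t : ℝ)) ^ (1 - 45 / 10 ^ 9 : ℝ) :=
    Real.rpow_le_rpow (by positivity) (by exact_mod_cast hjt) (by norm_num)
  have h5 : (p.support.length : ℝ) ≤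
      3 + (treeOf (hist (fun i => F i ω) (2 ^ j))).shape.pathBound := by exact_mod_cast hlen
  exact lt_of_lt_of_le (by linarith) ht

end RandomNetwork

/-! ### The marginals of the Dirichlet distribution -/

/-- The function `x ↦ x ^ (-1/2)` on the positive half-line. -/
def invSqrt (x : ℝ) : ℝ≥0∞ := if 0 < x then ENNReal.ofReal (x ^ (-(1 / 2) : ℝ)) else 0

lemma measurable_invSqrt : Measurable invSqrt :=
  Measurable.ite measurableSet_Ioi (by fun_prop) measurable_const

lemma invSqrt_of_pos {x : ℝ} (hx : 0 < x) : invSqrt x = ENNReal.ofReal (x ^ (-(1 / 2) : ℝ)) :=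
  if_pos hx

lemma invSqrt_of_nonpos {x : ℝ} (hx : x ≤ 0) : invSqrt x = 0 := if_neg hx.not_gt

lemma beta_half_half : beta (1 / 2) (1 / 2) = Real.pi := by
  rw [beta, Real.Gamma_one_half_eq, add_halves, Real.Gamma_one, div_one,
    Real.mul_self_sqrt Real.pi_pos.le]

lemma lintegral_comp_mul_left {s : ℝ} (hs : 0 < s) {f : ℝ → ℝ≥0∞} (hf : Measurable f) :
    ∫⁻ x, f x = ENNReal.ofReal s * ∫⁻ x, f (s * x) := by
  conv_lhs => rw [← Real.smul_map_volume_mul_left hs.ne']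
  rw [lintegral_smul_measure, lintegral_map hf (by fun_prop), abs_of_pos hs, smul_eq_mul]

/-- Substituting y = sz, the powers of s cancel and B(1/2, 1/2) = π remains. Since the value does
not depend on s, integrating out one coordinate of the Dirichlet density leaves x^(-1/2)/2. -/
lemma lintegral_invSqrt_mul_invSqrt {s : ℝ} (hs : 0 < s) :
    ∫⁻ y, invSqrt y * invSqrt (s - y) = ENNReal.ofReal Real.pi := by
  have hm : Measurable fun y => invSqrt y * invSqrt (s - y) :=
    measurable_invSqrt.mul (measurable_invSqrt.comp (by fun_prop))
  have h : ∀ z, invSqrt (s * z) * invSqrt (s - s * z) =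
      ENNReal.ofReal (s⁻¹ * Real.pi) * betaPDF (1 / 2) (1 / 2) z := by
    intro z
    rcases le_or_gt z 0 with hz | hz
    · rw [invSqrt_of_nonpos (mul_nonpos_of_nonneg_of_nonpos hs.le hz),
        betaPDF_eq_zero_of_nonpos hz]; simp
    rcases le_or_gt 1 z with hz1 | hz1
    · rw [invSqrt_of_nonpos (x := s - s * z) (by nlinarith), betaPDF_eq_zero_of_one_le hz1]; simp
    rw [invSqrt_of_pos (mul_pos hs hz), invSqrt_of_pos (x := s - s * z) (by nlinarith),
      betaPDF_of_pos_lt_one hz hz1, beta_half_half, ← ENNReal.ofReal_mul (by positivity),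
      ← ENNReal.ofReal_mul (by positivity)]
    congr 1
    rw [show s - s * z = s * (1 - z) by ring, Real.mul_rpow hs.le hz.le,
      Real.mul_rpow hs.le (by linarith)]
    have e : s ^ (-(1 / 2) : ℝ) * s ^ (-(1 / 2) : ℝ) = s⁻¹ := by
      rw [← Real.rpow_add hs, ← Real.rpow_neg_one]; norm_num
    have hpi := Real.pi_pos.ne'
    norm_num at e ⊢
    rw [mul_mul_mul_comm, e]
    field_simp
  rw [lintegral_comp_mul_left hs hm]
  simp only [h]
  rw [lintegral_const_mul' _ _ ENNReal.ofReal_ne_top,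
    lintegral_betaPDF_eq_one (by norm_num) (by norm_num), mul_one,
    ← ENNReal.ofReal_mul hs.le, ← mul_assoc, mul_inv_cancel₀ hs.ne', one_mul]

lemma invSqrt_mul_invSqrt_of_nonpos {s : ℝ} (hs : s ≤ 0) (y : ℝ) :
    invSqrt y * invSqrt (s - y) = 0 := by
  rcases le_or_gt y 0 with hy | hy
  · rw [invSqrt_of_nonpos hy, zero_mul]
  · rw [invSqrt_of_nonpos (x := s - y) (by linarith), mul_zero]

lemma gamma_quotient :
    Real.Gamma (∑ _j : Fin 3, (1 / 2 : ℝ)) / ∏ _j : Fin 3, Real.Gamma (1 / 2 : ℝ) =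
      1 / (2 * Real.pi) := by
  have h : Real.Gamma (∑ _j : Fin 3, (1 / 2 : ℝ)) = 1 / 2 * √Real.pi := by
    rw [← Real.Gamma_one_half_eq, ← Real.Gamma_add_one (by norm_num)]
    norm_num
  rw [h]
  simp only [Real.Gamma_one_half_eq, Finset.prod_const, Finset.card_univ, Fintype.card_fin]
  have h1 : √Real.pi ≠ 0 := (Real.sqrt_pos.2 Real.pi_pos).ne'
  rw [pow_succ, Real.sq_sqrt Real.pi_pos.le]
  have := Real.pi_pos.ne'
  field_simp

lemma dirichletPDF_half (x : Fin 2 → ℝ) :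
    dirichletPDF (n := 2) (fun _ => 1 / 2) x = ENNReal.ofReal (1 / (2 * Real.pi)) *
      (invSqrt (x 0) * (invSqrt (x 1) * invSqrt (1 - x 0 - x 1))) := by
  rw [dirichletPDF]
  split_ifs with h
  · obtain ⟨h1, h2⟩ := h
    rw [Fin.sum_univ_two] at h2
    have h3 : 0 < 1 - x 0 - x 1 := by linarith
    rw [gamma_quotient, invSqrt_of_pos (h1 0), invSqrt_of_pos (h1 1), invSqrt_of_pos h3,
      ← ENNReal.ofReal_mul (Real.rpow_nonneg (h1 1).le _),
      ← ENNReal.ofReal_mul (Real.rpow_nonneg (h1 0).le _),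
      ← ENNReal.ofReal_mul (by positivity)]
    congr 2
    rw [Fin.prod_univ_castSucc]
    simp only [simplexPoint, Fin.snoc_castSucc, Fin.snoc_last, Fin.prod_univ_two,
      Fin.sum_univ_two]
    rw [show 1 - (x 0 + x 1) = 1 - x 0 - x 1 by ring]
    norm_num
    ring
  · symm
    rw [Fin.forall_fin_two, Fin.sum_univ_two, not_and_or, not_and_or] at h
    rcases h with (h | h) | h
    · rw [invSqrt_of_nonpos (not_lt.1 h)]; simp
    · rw [invSqrt_of_nonpos (not_lt.1 h)]; simp
    · rw [invSqrt_of_nonpos (x := 1 - x 0 - x 1) (by linarith)]; simp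

lemma measurable_dirichletPDF_half :
    Measurable (dirichletPDF (n := 2) fun _ => 1 / 2) := by
  rw [show dirichletPDF (n := 2) (fun _ => 1 / 2) = _ from funext dirichletPDF_half]
  have := measurable_invSqrt
  fun_prop

lemma measurable_simplexPoint : Measurable (simplexPoint (n := 2)) := by
  refine measurable_pi_lambda _ fun i => ?_
  induction i using Fin.lastCases with
  | last => simp only [simplexPoint, Fin.snoc_last]; fun_prop
  | cast i => simp only [simplexPoint, Fin.snoc_castSucc]; fun_prop

/-- The Dirichlet(1/2, 1/2, 1/2) distribution. -/
abbrev dirichletHalf : Measure (Fin 3 → ℝ) := dirichletMeasure (n := 2) fun _ => 1 / 2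

lemma lintegral_dirichletHalf {G : (Fin 3 → ℝ) → ℝ≥0∞} (hG : Measurable G) :
    ∫⁻ x, G x ∂dirichletHalf = ENNReal.ofReal (1 / (2 * Real.pi)) * ∫⁻ x : ℝ, ∫⁻ y : ℝ,
      invSqrt x * (invSqrt y * invSqrt (1 - x - y)) * G (simplexPoint ![x, y]) := by
  have hw := measurable_invSqrt
  have hs := measurable_simplexPoint
  have hG' : Measurable fun x => G (simplexPoint x) := hG.comp hs
  have hF : Measurable fun p : ℝ × ℝ => invSqrt p.1 * (invSqrt p.2 * invSqrt (1 - p.1 - p.2)) *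
      G (simplexPoint ![p.1, p.2]) := by
    refine Measurable.mul (by fun_prop) (hG'.comp ?_)
    exact measurable_pi_lambda _ fun i => by fin_cases i <;> simp <;> fun_prop
  rw [dirichletHalf, dirichletMeasure, lintegral_map hG hs,
    lintegral_withDensity_eq_lintegral_mul _ measurable_dirichletPDF_half hG']
  have h := (volume_preserving_finTwoArrow ℝ).lintegral_comp hF
  rw [Measure.volume_eq_prod, lintegral_prod _ hF.aemeasurable] at h
  rw [← h, ← lintegral_const_mul' _ _ ENNReal.ofReal_ne_top]
  refine lintegral_congr fun x => ?_
  have e : ![x 0, x 1] = x := by ext i; fin_cases i <;> rfl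
  simp only [Pi.mul_apply, dirichletPDF_half, MeasurableEquiv.finTwoArrow_apply, e]
  ring

lemma lintegral_marginal_aux {f : ℝ → ℝ≥0∞} :
    ENNReal.ofReal (1 / (2 * Real.pi)) * ∫⁻ x : ℝ, ∫⁻ y : ℝ,
      invSqrt x * (invSqrt y * invSqrt (1 - x - y)) * f x =
      ∫⁻ a in Set.Ioo 0 1, ENNReal.ofReal (1 / 2 * a ^ (-(1 / 2) : ℝ)) * f a := by
  rw [← lintegral_indicator measurableSet_Ioo, ← lintegral_const_mul' _ _ ENNReal.ofReal_ne_top]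
  refine lintegral_congr fun x => ?_
  have hw := measurable_invSqrt
  have hm : Measurable fun y => invSqrt y * invSqrt (1 - x - y) := by fun_prop
  have e : ∀ y, invSqrt x * (invSqrt y * invSqrt (1 - x - y)) * f x =
      (invSqrt x * f x) * (invSqrt y * invSqrt (1 - x - y)) := fun y => by ring
  simp only [e]
  rw [lintegral_const_mul _ hm]
  by_cases hx : x ∈ Set.Ioo 0 1
  · rw [Set.indicator_of_mem hx, lintegral_invSqrt_mul_invSqrt (by linarith [hx.2]),
      invSqrt_of_pos hx.1, mul_assoc, mul_comm (f x), ← mul_assoc, ← mul_assoc, mul_assoc _ _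
      (ENNReal.ofReal Real.pi), ← ENNReal.ofReal_mul (Real.rpow_nonneg hx.1.le _),
      ← ENNReal.ofReal_mul (by positivity)]
    congr 2
    have := Real.pi_pos.ne'
    field_simp
  · rw [Set.indicator_of_notMem hx]
    rcases le_or_gt x 0 with h0 | h0
    · rw [invSqrt_of_nonpos h0]; simp
    · have h1 : 1 - x ≤ 0 := by
        by_contra h; exact hx ⟨h0, by linarith⟩
      simp [invSqrt_mul_invSqrt_of_nonpos h1]

/-- The marginals of Dirichlet(1/2, 1/2, 1/2) are Beta(1/2, 1) distributions. -/
lemma lintegral_dirichletHalf_apply (i : Fin 3) {f : ℝ → ℝ≥0∞} (hf : Measurable f) :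
    ∫⁻ x, f (x i) ∂dirichletHalf =
      ∫⁻ a in Set.Ioo 0 1, ENNReal.ofReal (1 / 2 * a ^ (-(1 / 2) : ℝ)) * f a := by
  have hw := measurable_invSqrt
  have hG : Measurable fun x : Fin 3 → ℝ => f (x i) := by fun_prop
  rw [lintegral_dirichletHalf hG, ← lintegral_marginal_aux]
  have e0 : ∀ x y : ℝ, simplexPoint ![x, y] 0 = x := fun x y => rfl
  have e1 : ∀ x y : ℝ, simplexPoint ![x, y] 1 = y := fun x y => rfl
  have e2 : ∀ x y : ℝ, simplexPoint ![x, y] 2 = 1 - x - y := fun x y => by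
    have : simplexPoint ![x, y] 2 = 1 - ∑ i, ![x, y] i := rfl
    rw [this, Fin.sum_univ_two]
    simp; ring
  have hswap : ∫⁻ x : ℝ, ∫⁻ y : ℝ, invSqrt x * (invSqrt y * invSqrt (1 - x - y)) * f y =
      ∫⁻ x : ℝ, ∫⁻ y : ℝ, invSqrt x * (invSqrt y * invSqrt (1 - x - y)) * f x := by
    rw [lintegral_lintegral_swap]
    · refine lintegral_congr fun x => lintegral_congr fun y => ?_
      rw [show 1 - y - x = 1 - x - y by ring]
      ring
    · refine Measurable.aemeasurable ?_
      simp only [Function.uncurry_def]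
      fun_prop
  congr 1
  fin_cases i
  · simp only [Fin.zero_eta, e0]
  · simp only [Fin.mk_one, e1]
    exact hswap
  · simp only [Fin.reduceFinMk, e2]
    rw [← hswap]
    -- The reflection y ↦ 1 - x - y exchanges the second and third coordinates.
    refine lintegral_congr fun x => ?_
    rw [← lintegral_sub_left_eq_self _ (1 - x)]
    refine lintegral_congr fun y => ?_
    rw [show 1 - x - (1 - x - y) = y by ring]
    ring

lemma ae_dirichletHalf_mem_Ioo (i : Fin 3) : ∀ᵐ x ∂dirichletHalf, x i ∈ Set.Ioo (0 : ℝ) 1 := by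
  have hm : Measurable fun x : Fin 3 → ℝ => (Set.Ioo (0 : ℝ) 1)ᶜ.indicator (1 : ℝ → ℝ≥0∞) (x i) :=
    (measurable_one.indicator measurableSet_Ioo.compl).comp (measurable_pi_apply i)
  have h := lintegral_dirichletHalf_apply i (f := (Set.Ioo 0 1)ᶜ.indicator 1)
    (measurable_one.indicator measurableSet_Ioo.compl)
  rw [setLIntegral_congr_fun (g := fun _ => 0) measurableSet_Ioo
    (fun a ha => by simp [Set.indicator_of_notMem (Set.notMem_compl_iff.2 ha)]),
    lintegral_zero, lintegral_eq_zero_iff hm] at h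
  filter_upwards [h] with x hx
  by_contra hc
  simp [Set.indicator_of_mem (show x i ∈ (Set.Ioo (0 : ℝ) 1)ᶜ from hc)] at hx

/-! ### The moment bound for `1 - Υ` -/

lemma lintegral_Ioc_half_rpow {s : ℝ} (hs : 0 ≤ s) :
    ∫⁻ a in Set.Ioc 0 s, ENNReal.ofReal (1 / 2 * a ^ (-(1 / 2) : ℝ)) = ENNReal.ofReal (√s) := by
  have hi : IntervalIntegrable (fun a : ℝ => 1 / 2 * a ^ (-(1 / 2) : ℝ)) volume 0 s :=
    (intervalIntegral.intervalIntegrable_rpow' (by norm_num)).const_mul _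
  rw [intervalIntegrable_iff_integrableOn_Ioc_of_le hs] at hi
  rw [← ofReal_integral_eq_lintegral_ofReal hi, ← intervalIntegral.integral_of_le hs,
    intervalIntegral.integral_const_mul, integral_rpow (Or.inl (by norm_num)), Real.sqrt_eq_rpow]
  · congr 1
    norm_num
    ring
  · filter_upwards [ae_restrict_mem measurableSet_Ioc] with a ha
    exact mul_nonneg (by norm_num) (Real.rpow_nonneg ha.1.le _)

/-- The Laplace transform of the Beta(1/2, 1) distribution. -/
def laplace (lam b : ℝ) : ℝ≥0∞ :=
  ∫⁻ a in Set.Ioo 0 1, ENNReal.ofReal (1 / 2 * a ^ (-(1 / 2) : ℝ)) *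
    ENNReal.ofReal (Real.exp (-(lam * (a * b))))

lemma measurable_laplace (lam : ℝ) : Measurable (laplace lam) := by
  unfold laplace
  refine Measurable.lintegral_prod_right' (f := fun p : ℝ × ℝ =>
    ENNReal.ofReal (1 / 2 * p.2 ^ (-(1 / 2) : ℝ)) *
      ENNReal.ofReal (Real.exp (-(lam * (p.2 * p.1))))) ?_
  fun_prop

lemma laplace_le_one {lam b : ℝ} (hlam : 0 < lam) (hb : 0 < b) : laplace lam b ≤ 1 := by
  calc laplace lam b ≤ ∫⁻ a in Set.Ioo 0 1, ENNReal.ofReal (1 / 2 * a ^ (-(1 / 2) : ℝ)) := by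
        refine setLIntegral_mono' measurableSet_Ioo fun a ha => ?_
        refine mul_le_of_le_one_right zero_le ?_
        rw [← ENNReal.ofReal_one]
        refine ENNReal.ofReal_le_ofReal (Real.exp_le_one_iff.2 ?_)
        have := mul_pos hlam (mul_pos ha.1 hb)
        linarith
    _ ≤ ∫⁻ a in Set.Ioc 0 1, ENNReal.ofReal (1 / 2 * a ^ (-(1 / 2) : ℝ)) :=
        lintegral_mono_set Set.Ioo_subset_Ioc_self
    _ = 1 := by rw [lintegral_Ioc_half_rpow zero_le_one]; simp

/-- The scale on which the product of two Beta(1/2, 1) variables is felt. -/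
def scale (lam : ℝ) : ℝ := √Real.pi / 2 * lam ^ (-(1 / 2) : ℝ)

lemma scale_pos {lam : ℝ} (hlam : 0 < lam) : 0 < scale lam :=
  mul_pos (half_pos (Real.sqrt_pos.2 Real.pi_pos)) (Real.rpow_pos_of_pos hlam _)

lemma laplace_le {lam b : ℝ} (hlam : 0 < lam) (hb : 0 < b) :
    laplace lam b ≤ ENNReal.ofReal (scale lam * b ^ (-(1 / 2) : ℝ)) := by
  have hr : 0 < lam * b := mul_pos hlam hb
  have hval := Real.integral_rpow_mul_exp_neg_mul_Ioi (a := 1 / 2) (by norm_num) hr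
  have hint : IntegrableOn (fun a : ℝ => a ^ (1 / 2 - 1 : ℝ) * Real.exp (-(lam * b * a)))
      (Set.Ioi 0) := by
    have := integrableOn_rpow_mul_exp_neg_mul_rpow (s := 1 / 2 - 1) (p := 1) (b := lam * b)
      (by norm_num) one_pos hr
    simpa using this
  calc laplace lam b
      ≤ ∫⁻ a in Set.Ioi 0, ENNReal.ofReal (1 / 2 *
          (a ^ (1 / 2 - 1 : ℝ) * Real.exp (-(lam * b * a)))) := by
        refine (setLIntegral_mono' measurableSet_Ioo fun a ha => le_of_eq ?_).trans
          (lintegral_mono_set Set.Ioo_subset_Ioi_self)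
        rw [← ENNReal.ofReal_mul (mul_nonneg (by norm_num) (Real.rpow_nonneg ha.1.le _)),
          show (-(1 / 2) : ℝ) = 1 / 2 - 1 by norm_num,
          show lam * (a * b) = lam * b * a by ring, mul_assoc]
    _ = ENNReal.ofReal (scale lam * b ^ (-(1 / 2) : ℝ)) := by
        rw [← ofReal_integral_eq_lintegral_ofReal (hint.const_mul _), integral_const_mul, hval,
          Real.Gamma_one_half_eq, one_div (lam * b), Real.inv_rpow hr.le, ← Real.rpow_neg hr.le,
          Real.mul_rpow hlam.le hb.le, scale]
        · congr 1; ring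
        · filter_upwards [ae_restrict_mem measurableSet_Ioi] with a ha
          exact mul_nonneg (by norm_num) (mul_nonneg (Real.rpow_nonneg (le_of_lt ha) _)
            (Real.exp_pos _).le)

/-- With k the scale, the two bounds 1 and k b^(-1/2) for the Laplace transform cross at b = k². The
lower range contributes k, the upper one ∫ k/(2b) db = -k log k. -/
lemma lintegral_laplace_le {lam : ℝ} (hlam : 0 < lam) (h1 : scale lam < 1) :
    ∫⁻ b in Set.Ioo 0 1, ENNReal.ofReal (1 / 2 * b ^ (-(1 / 2) : ℝ)) * laplace lam b ≤
      ENNReal.ofReal (scale lam * (1 - Real.log (scale lam))) := by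
  set k := scale lam with hk
  have hk0 : 0 < k := scale_pos hlam
  have hk2 : k ^ 2 ≤ 1 := pow_le_one₀ hk0.le h1.le
  have hk20 : 0 < k ^ 2 := by positivity
  have hsub : Set.Ioo (0 : ℝ) 1 ⊆ Set.Ioc 0 (k ^ 2) ∪ Set.Ioc (k ^ 2) 1 := by
    rw [Set.Ioc_union_Ioc_eq_Ioc hk20.le hk2]; exact Set.Ioo_subset_Ioc_self
  have hA : ∫⁻ b in Set.Ioc 0 (k ^ 2), ENNReal.ofReal (1 / 2 * b ^ (-(1 / 2) : ℝ)) *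
      laplace lam b ≤ ENNReal.ofReal k := by
    refine (setLIntegral_mono' measurableSet_Ioc fun b hb =>
      mul_le_of_le_one_right zero_le (laplace_le_one hlam hb.1)).trans (le_of_eq ?_)
    rw [lintegral_Ioc_half_rpow hk20.le, Real.sqrt_sq hk0.le]
  have hB : ∫⁻ b in Set.Ioc (k ^ 2) 1, ENNReal.ofReal (1 / 2 * b ^ (-(1 / 2) : ℝ)) *
      laplace lam b ≤ ENNReal.ofReal (-(k * Real.log k)) := by
    calc _ ≤ ∫⁻ b in Set.Ioc (k ^ 2) 1, ENNReal.ofReal (k / 2 * b⁻¹) := by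
          refine setLIntegral_mono' measurableSet_Ioc fun b hb => ?_
          have hb0 : 0 < b := hk20.trans hb.1
          refine (mul_le_mul_right (laplace_le hlam hb0) _).trans (le_of_eq ?_)
          rw [← ENNReal.ofReal_mul (by positivity)]
          congr 1
          have : b ^ (-(1 / 2) : ℝ) * b ^ (-(1 / 2) : ℝ) = b⁻¹ := by
            rw [← Real.rpow_add hb0, ← Real.rpow_neg_one]; norm_num
          rw [← this]; ring
      _ = ENNReal.ofReal (-(k * Real.log k)) := by
          have hi : IntervalIntegrable (fun b : ℝ => k / 2 * b⁻¹) volume (k ^ 2) 1 := by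
            refine (intervalIntegrable_inv_iff.2 (Or.inr ?_)).const_mul _
            rw [Set.uIcc_of_le hk2]
            exact fun h => absurd h.1 (not_le.2 hk20)
          rw [intervalIntegrable_iff_integrableOn_Ioc_of_le hk2] at hi
          rw [← ofReal_integral_eq_lintegral_ofReal hi, ← intervalIntegral.integral_of_le hk2,
            intervalIntegral.integral_const_mul, integral_inv_of_pos hk20 one_pos,
            Real.log_div one_ne_zero hk20.ne', Real.log_one, Real.log_pow]
          · congr 1; push_cast; ring
          · filter_upwards [ae_restrict_mem measurableSet_Ioc] with b hb
            have : 0 < b := hk20.trans hb.1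
            exact (by positivity : 0 ≤ k / 2 * b⁻¹)
  refine (lintegral_mono_set hsub).trans ((lintegral_union_le _ _ _).trans
    ((add_le_add hA hB).trans (le_of_eq ?_)))
  rw [← ENNReal.ofReal_add hk0.le]
  · congr 1; ring
  · have := Real.log_neg hk0 h1
    nlinarith

lemma scale_lt_one {lam : ℝ} (hlam : 1 ≤ lam) : scale lam < 1 := by
  have h1 : √Real.pi < 2 := by
    rw [Real.sqrt_lt' two_pos]; linarith [Real.pi_lt_d2]
  have h2 : lam ^ (-(1 / 2) : ℝ) ≤ 1 := Real.rpow_le_one_of_one_le_of_nonpos hlam (by norm_num)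
  have h3 : 0 < lam ^ (-(1 / 2) : ℝ) := Real.rpow_pos_of_pos (by linarith) _
  rw [scale]
  nlinarith [Real.sqrt_nonneg Real.pi]

lemma scale_bound_lt_g {lam : ℝ} (hlam : 1 + Real.exp (-2) ≤ lam) :
    9 * (scale lam * (1 - Real.log (scale lam))) < g lam := by
  have hm : Real.exp (-2) ≤ lam - 1 := by linarith
  have hm0 : 0 < lam - 1 := (Real.exp_pos _).trans_le hm
  have hl0 : 0 < lam := by linarith
  have hpi := Real.pi_pos
  have hs : 0 < √Real.pi := Real.sqrt_pos.2 hpi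
  set L := Real.log lam with hL
  set l := Real.log (lam - 1) with hl
  have hl2 : -2 ≤ l := (Real.le_log_iff_exp_le hm0).2 hm
  have hlL : l ≤ L := Real.log_le_log hm0 (by linarith)
  have e1 : lam ^ (-(1 / 2) : ℝ) = Real.exp (-(L / 2)) := by
    rw [Real.rpow_def_of_pos hl0]; congr 1; ring
  have e2 : 9 * lam / (2 * (lam - 1) ^ (3 / 2 : ℝ)) =
      9 / 2 * (Real.exp (-(L / 2)) * Real.exp (3 / 2 * (L - l))) := by
    rw [Real.rpow_def_of_pos hm0, ← hl]
    conv_lhs => rw [← Real.exp_log hl0, ← hL]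
    rw [← Real.exp_add, mul_div_mul_comm, ← Real.exp_sub]
    congr 2; ring
  have e3 : Real.log (scale lam) = Real.log Real.pi / 2 - Real.log 2 - L / 2 := by
    rw [scale, e1, Real.log_mul (by positivity) (Real.exp_pos _).ne', Real.log_exp,
      Real.log_div hs.ne' two_ne_zero, Real.log_sqrt hpi.le]
    ring
  have h3 : Real.log 3 ≤ Real.log Real.pi :=
    Real.log_le_log (by norm_num) (by linarith [Real.pi_gt_three])
  -- Hence the summand 4/9 in g is at least √π/4, so that √π can be factored out.
  have h4 : √Real.pi ≤ 16 / 9 := by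
    rw [Real.sqrt_le_left (by norm_num)]; linarith [Real.pi_lt_d2]
  set t := L - l with ht
  have ht0 : 0 ≤ t := by linarith
  have hexp : 1 + 3 / 2 * t + 9 / 8 * t ^ 2 ≤ Real.exp (3 / 2 * t) := by
    have := Real.quadratic_le_exp_of_nonneg (by linarith : 0 ≤ 3 / 2 * t)
    linarith
  have key : √Real.pi * (1 - (Real.log Real.pi / 2 - Real.log 2 - L / 2)) <
      Real.exp (3 / 2 * t) * (√Real.pi + √Real.pi * l / 2 + 4 / 9) := by
    have a1 : √Real.pi + √Real.pi * l / 2 + 4 / 9 ≥ √Real.pi * (1 + l / 2 + 1 / 4) := by linarith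
    have a2 : 1 - (Real.log Real.pi / 2 - Real.log 2 - L / 2) <
        Real.exp (3 / 2 * t) * (1 + l / 2 + 1 / 4) := by
      have b1 : (1 + 3 / 2 * t + 9 / 8 * t ^ 2) * (1 + l / 2 + 1 / 4) ≤
          Real.exp (3 / 2 * t) * (1 + l / 2 + 1 / 4) :=
        mul_le_mul_of_nonneg_right hexp (by linarith)
      -- Here λ ≥ 1 + e⁻² enters, through l ≥ -2.
      have b2 : 0 ≤ (3 / 2 * t + 9 / 8 * t ^ 2) * (1 + l / 2) :=
        mul_nonneg (by positivity) (by linarith)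
      have := Real.log_two_lt_d9
      have := Real.log_three_gt_d9
      -- What remains is 1/4 - t/8 + 9t²/32 > log 2 - (log π)/2; the left side is minimal at t =
      -- 2/9.
      nlinarith [sq_nonneg (t - 2 / 9)]
    calc _ < √Real.pi * (Real.exp (3 / 2 * t) * (1 + l / 2 + 1 / 4)) :=
          mul_lt_mul_of_pos_left a2 hs
      _ = Real.exp (3 / 2 * t) * (√Real.pi * (1 + l / 2 + 1 / 4)) := by ring
      _ ≤ _ := mul_le_mul_of_nonneg_left a1 (Real.exp_pos _).le
  rw [g, e2, e3, scale, e1]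
  have := mul_lt_mul_of_pos_left key (by positivity : 0 < 9 / 2 * Real.exp (-(L / 2)))
  linarith

lemma measurable_upsilon : Measurable upsilon :=
  (Continuous.finset_inf'_apply Finset.univ_nonempty fun p _ =>
    (by fun_prop : Continuous fun v : Fin 4 → Fin 3 → ℝ =>
      v 0 p.1 * v p.1.succ p.2)).measurable

/-! ### The expectation for a Dirichlet quadruple -/

section Quadruple

variable {Ω : Type*} [MeasurableSpace Ω] {P : Measure Ω} [IsProbabilityMeasure P]
  {D : Fin 4 → Ω → Fin 3 → ℝ}

/-- By independence of `D 0` and `D p.1.succ`, the factor A may be integrated first for fixed B,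
giving `laplace` at B. -/
lemma IsDirichletQuadruple.lintegral_exp_le (hD : IsDirichletQuadruple P D) {lam : ℝ}
    (hlam : 1 ≤ lam) (p : Fin 3 × Fin 3) :
    ∫⁻ ω, ENNReal.ofReal (Real.exp (-(lam * (D 0 ω p.1 * D p.1.succ ω p.2)))) ∂P ≤
      ENNReal.ofReal (scale lam * (1 - Real.log (scale lam))) := by
  have h0 := hD.law 0
  have hk := hD.law p.1.succ
  have : IsProbabilityMeasure dirichletHalf := hk.isProbabilityMeasure_iff.1 inferInstance
  have hind : D p.1.succ ⟂ᵢ[P] D 0 := hD.indep.indepFun (Fin.succ_ne_zero _)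
  have hprod := (indepFun_iff_map_prod_eq_prod_map_map hk.aemeasurable h0.aemeasurable).1 hind
  rw [hk.map_eq, h0.map_eq] at hprod
  have hG : Measurable fun q : (Fin 3 → ℝ) × (Fin 3 → ℝ) =>
      ENNReal.ofReal (Real.exp (-(lam * (q.2 p.1 * q.1 p.2)))) := by fun_prop
  have e := lintegral_map' (μ := P) hG.aemeasurable (hk.aemeasurable.prodMk h0.aemeasurable)
  rw [hprod, lintegral_prod _ hG.aemeasurable] at e
  rw [← e]
  have e2 : ∀ y : Fin 3 → ℝ, ∫⁻ x, ENNReal.ofReal (Real.exp (-(lam * (x p.1 * y p.2))))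
      ∂dirichletHalf = laplace lam (y p.2) := fun y =>
    lintegral_dirichletHalf_apply p.1
      (f := fun a => ENNReal.ofReal (Real.exp (-(lam * (a * y p.2))))) (by fun_prop)
  simp only [e2]
  rw [lintegral_dirichletHalf_apply p.2 (measurable_laplace lam)]
  exact lintegral_laplace_le (by linarith) (scale_lt_one hlam)

lemma one_sub_upsilon_rpow_mem {v : Fin 4 → Fin 3 → ℝ} (hv : ∀ k i, v k i ∈ Set.Ioo (0 : ℝ) 1)
    {lam : ℝ} (hlam : 0 ≤ lam) :
    0 ≤ (1 - upsilon v) ^ lam ∧ (1 - upsilon v) ^ lam ≤ 1 ∧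
      ∃ p : Fin 3 × Fin 3, (1 - upsilon v) ^ lam ≤
        Real.exp (-(lam * (v 0 p.1 * v p.1.succ p.2))) := by
  obtain ⟨p, -, hp⟩ := Finset.exists_mem_eq_inf' Finset.univ_nonempty
    fun p : Fin 3 × Fin 3 => v 0 p.1 * v p.1.succ p.2
  have hu : upsilon v = v 0 p.1 * v p.1.succ p.2 := hp
  have h1 := hv 0 p.1
  have h2 := hv p.1.succ p.2
  have h3 : 0 < upsilon v := hu ▸ mul_pos h1.1 h2.1
  have h4 : upsilon v ≤ 1 := hu ▸ mul_le_one₀ h1.2.le h2.1.le h2.2.le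
  have h5 : 0 ≤ 1 - upsilon v := by linarith
  refine ⟨Real.rpow_nonneg h5 _, Real.rpow_le_one h5 (by linarith) hlam, p, ?_⟩
  rw [← hu]
  refine (Real.rpow_le_rpow h5 (Real.one_sub_le_exp_neg _) hlam).trans (le_of_eq ?_)
  rw [← Real.exp_mul]; congr 1; ring

/-- The moment bound for `1 - Υ`. -/
theorem IsDirichletQuadruple.integral_lt (hD : IsDirichletQuadruple P D) {lam : ℝ}
    (hlam : 1 + Real.exp (-2) ≤ lam) :
    Integrable (fun ω => (1 - upsilon fun k => D k ω) ^ lam) P ∧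
      ∫ ω, (1 - upsilon fun k => D k ω) ^ lam ∂P < g lam := by
  have hlam1 : 1 ≤ lam := by linarith [Real.exp_pos (-2)]
  have hmem : ∀ᵐ ω ∂P, ∀ k i, D k ω i ∈ Set.Ioo (0 : ℝ) 1 :=
    ae_all_iff.2 fun k => ae_all_iff.2 fun i => by
      refine ae_of_ae_map (f := D k) (p := fun x : Fin 3 → ℝ => x i ∈ Set.Ioo (0 : ℝ) 1)
        (hD.law k).aemeasurable ?_
      rw [(hD.law k).map_eq]
      exact ae_dirichletHalf_mem_Ioo i
  have hm : AEMeasurable (fun ω => (1 - upsilon fun k => D k ω) ^ lam) P :=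
    ((measurable_upsilon.comp_aemeasurable
      (aemeasurable_pi_lambda _ fun k => (hD.law k).aemeasurable)).const_sub 1).pow_const lam
  have hint : Integrable (fun ω => (1 - upsilon fun k => D k ω) ^ lam) P := by
    refine Integrable.of_bound hm.aestronglyMeasurable 1 ?_
    filter_upwards [hmem] with ω hω
    have := one_sub_upsilon_rpow_mem hω (by linarith : 0 ≤ lam)
    rw [Real.norm_eq_abs, abs_of_nonneg this.1]
    exact this.2.1
  refine ⟨hint, lt_of_le_of_lt ?_ (scale_bound_lt_g hlam)⟩
  have hb0 : 0 ≤ 9 * (scale lam * (1 - Real.log (scale lam))) := by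
    have h1 := scale_pos (by linarith : 0 < lam)
    have := Real.log_neg h1 (scale_lt_one hlam1)
    have : 0 ≤ 1 - Real.log (scale lam) := by linarith
    positivity
  rw [← ENNReal.ofReal_le_ofReal_iff hb0, ofReal_integral_eq_lintegral_ofReal hint
    (by filter_upwards [hmem] with ω hω
        exact (one_sub_upsilon_rpow_mem hω (by linarith : 0 ≤ lam)).1)]
  calc ∫⁻ ω, ENNReal.ofReal ((1 - upsilon fun k => D k ω) ^ lam) ∂P
      ≤ ∫⁻ ω, ∑ p : Fin 3 × Fin 3,
          ENNReal.ofReal (Real.exp (-(lam * (D 0 ω p.1 * D p.1.succ ω p.2)))) ∂P := by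
        refine lintegral_mono_ae ?_
        filter_upwards [hmem] with ω hω
        obtain ⟨-, -, p, hp⟩ := one_sub_upsilon_rpow_mem hω (by linarith : 0 ≤ lam)
        exact (ENNReal.ofReal_le_ofReal hp).trans (Finset.single_le_sum
          (f := fun p : Fin 3 × Fin 3 =>
            ENNReal.ofReal (Real.exp (-(lam * (D 0 ω p.1 * D p.1.succ ω p.2)))))
          (fun _ _ => zero_le) (Finset.mem_univ p))
    _ = ∑ p : Fin 3 × Fin 3, ∫⁻ ω,
          ENNReal.ofReal (Real.exp (-(lam * (D 0 ω p.1 * D p.1.succ ω p.2)))) ∂P := by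
        refine lintegral_finsetSum' _ fun p _ => ?_
        have ha : ∀ k i, AEMeasurable (fun ω => D k ω i) P := fun k i =>
          (measurable_pi_apply i).comp_aemeasurable (hD.law k).aemeasurable
        exact (Real.measurable_exp.comp_aemeasurable
          ((((ha _ _).mul (ha _ _)).const_mul lam).neg)).ennreal_ofReal
    _ ≤ ∑ _p : Fin 3 × Fin 3, ENNReal.ofReal (scale lam * (1 - Real.log (scale lam))) :=
        Finset.sum_le_sum fun p _ => hD.lintegral_exp_le hlam1 p
    _ = ENNReal.ofReal (9 * (scale lam * (1 - Real.log (scale lam)))) := by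
        rw [Finset.sum_const, nsmul_eq_mul, ENNReal.ofReal_mul (p := 9) (by norm_num)]
        simp

end Quadruple

/-! ### The explicit constants -/

lemma log_720_lt : Real.log 720 < 65793 / 10 ^ 4 ∧ 6 < Real.log 720 := by
  have e : Real.log 720 = 4 * Real.log 2 + 2 * Real.log 3 + Real.log 5 := by
    rw [show (720 : ℝ) = 2 ^ 4 * 3 ^ 2 * 5 by norm_num, Real.log_mul (by norm_num) (by norm_num),
      Real.log_mul (by norm_num) (by norm_num), Real.log_pow, Real.log_pow]
    norm_num
  rw [e]
  have := Real.log_two_lt_d9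
  have := Real.log_two_gt_d9
  have := Real.log_three_lt_d9
  have := Real.log_three_gt_d9
  have := Real.log_five_lt_d9
  have := Real.log_five_gt_d9
  constructor <;> linarith

/-- The value of 9g is just below 0.586. The bound 75/128 = 3·5²/2⁷ is a close rational whose
logarithm reduces to those of 2, 3 and 5. -/
lemma g_million : 0 < g (10 ^ 6) ∧ 9 * g (10 ^ 6) ≤ 75 / 128 := by
  have hs : √Real.pi ≤ 17725 / 10000 := by
    rw [Real.sqrt_le_left (by norm_num)]; linarith [Real.pi_lt_d4]
  have hs0 : 0 < √Real.pi := Real.sqrt_pos.2 Real.pi_pos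
  have hl : Real.log 999999 ≤ 13815512 / 10 ^ 6 := by
    have h1 : Real.log 999999 ≤ Real.log (10 ^ 6) :=
      Real.log_le_log (by norm_num) (by norm_num)
    rw [Real.log_pow, Real.log_ten_eq] at h1
    have := Real.log_two_lt_d9
    have := Real.log_five_lt_d9
    push_cast at h1
    linarith
  have hl0 : 0 ≤ Real.log 999999 := Real.log_nonneg (by norm_num)
  have hp : (999998 * 1000 : ℝ) ≤ (999999 : ℝ) ^ (3 / 2 : ℝ) := by
    rw [show (3 / 2 : ℝ) = 1 + 1 / 2 by norm_num, Real.rpow_add (by norm_num), Real.rpow_one,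
      ← Real.sqrt_eq_rpow]
    have : (999999 / 1000 : ℝ) ≤ √(999999 : ℝ) := Real.le_sqrt_of_sq_le (by norm_num)
    linarith
  have hB : √Real.pi + √Real.pi * Real.log 999999 / 2 + 4 / 9 ≤ 14462 / 1000 := by
    have := mul_le_mul hs hl hl0 (by norm_num)
    norm_num at this
    linarith
  have hB0 : 0 < √Real.pi + √Real.pi * Real.log 999999 / 2 + 4 / 9 := by positivity
  have hA0 : (0 : ℝ) < 2 * (999999 : ℝ) ^ (3 / 2 : ℝ) := by linarith
  have hA : (9 : ℝ) * 10 ^ 6 / (2 * (999999 : ℝ) ^ (3 / 2 : ℝ)) ≤ 45001 / 10 ^ 7 := by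
    rw [div_le_iff₀ hA0]; linarith
  have hA' : (0 : ℝ) < 9 * 10 ^ 6 / (2 * (999999 : ℝ) ^ (3 / 2 : ℝ)) := div_pos (by norm_num) hA0
  rw [g, show (10 ^ 6 - 1 : ℝ) = 999999 by norm_num]
  refine ⟨mul_pos hA' hB0, ?_⟩
  have := mul_le_mul hA hB hB0.le (by norm_num)
  norm_num at this ⊢
  linarith

lemma three_exp_log_lt : 3 * Real.exp 1 * Real.log 720 < 2 * √720 := by
  have h1 : (2683 / 100 : ℝ) ≤ √720 := Real.le_sqrt_of_sq_le (by norm_num)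
  have h2 := Real.exp_one_lt_d9
  have h3 := log_720_lt
  have h4 : Real.exp 1 * Real.log 720 ≤ 2.7182818286 * (65793 / 10 ^ 4) :=
    mul_le_mul h2.le h3.1.le (by linarith) (by norm_num)
  norm_num at h4
  linarith

lemma exponent_lt : max (1 - Real.log ((9 * g (10 ^ 6)) ^ (-1 / 10 ^ 6 : ℝ)) / (2 * Real.log 720))
    (Real.log 8 / (2 * Real.log 720)) < 1 - 4 * 10 ^ (-8 : ℤ) := by
  obtain ⟨hg, hg'⟩ := g_million
  obtain ⟨h1, h2⟩ := log_720_lt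
  have hlog : Real.log (9 * g (10 ^ 6)) ≤ -53 / 100 := by
    refine (Real.log_le_log (by linarith) hg').trans ?_
    rw [show (75 / 128 : ℝ) = 3 * 5 ^ 2 / 2 ^ 7 by norm_num,
      Real.log_div (by norm_num) (by norm_num), Real.log_mul (by norm_num) (by norm_num),
      Real.log_pow, Real.log_pow]
    have := Real.log_two_gt_d9
    have := Real.log_three_lt_d9
    have := Real.log_five_lt_d9
    push_cast
    linarith
  rw [max_lt_iff, Real.log_rpow (by linarith)]
  constructor
  · have : (4 * 10 ^ (-8 : ℤ) : ℝ) <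
        -1 / 10 ^ 6 * Real.log (9 * g (10 ^ 6)) / (2 * Real.log 720) := by
      rw [lt_div_iff₀ (by linarith)]
      norm_num
      linarith
    linarith
  · rw [div_lt_iff₀ (by linarith), show (8 : ℝ) = 2 ^ 3 by norm_num, Real.log_pow]
    have := Real.log_two_lt_d9
    norm_num
    linarith

end Apollonian

end

theorem mainTheorem7 :
    -- the bound on `E[(1 - Υ)^λ]`
    (∀ {Ω : Type*} [MeasurableSpace Ω] (P : Measure Ω) [IsProbabilityMeasure P]
        (D : Fin 4 → Ω → Fin 3 → ℝ), Apollonian.IsDirichletQuadruple P D →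
      ∀ lam : ℝ, 1 + Real.exp (-2) ≤ lam →
        Integrable (fun ω => (1 - Apollonian.upsilon (fun k => D k ω)) ^ lam) P ∧
        ∫ ω, (1 - Apollonian.upsilon (fun k => D k ω)) ^ lam ∂P < Apollonian.g lam) ∧
    -- the explicit constants satisfy the conditions that yield the exponent `δ`
    (∀ lam kap tau δ : ℝ, lam = 10 ^ 6 → kap = (9 * Apollonian.g lam) ^ (-1 / lam) →
        tau = 720 → δ = 1 - 4 * 10 ^ (-8 : ℤ) →
      0 < kap ∧
      3 * Real.exp 1 * Real.log tau < 2 * √tau ∧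
      max (1 - Real.log kap / (2 * Real.log tau)) (Real.log 8 / (2 * Real.log tau)) < δ ∧
      ∀ {Ω : Type*} [MeasurableSpace Ω] (P : Measure Ω) [IsProbabilityMeasure P]
        (D : Fin 4 → Ω → Fin 3 → ℝ), Apollonian.IsDirichletQuadruple P D →
        9 * kap ^ lam * ∫ ω, (1 - Apollonian.upsilon (fun k => D k ω)) ^ lam ∂P < 1) ∧
    -- almost surely, eventually every path in `RAN_t` has fewer than `t ^ δ` vertices
    (∀ {Ω : Type*} [MeasurableSpace Ω] (P : Measure Ω) [IsProbabilityMeasure P]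
        (F : ℕ → Ω → Finset ℕ), Apollonian.IsUniformSubdivision P F →
      ∀ᵐ ω ∂P, ∀ᶠ t : ℕ in atTop,
        ∀ u v, ∀ p : (Apollonian.RAN F t ω).Walk u v, p.IsPath →
          (p.support.length : ℝ) < (t : ℝ) ^ (1 - 4 * 10 ^ (-8 : ℤ) : ℝ)) := by
  refine ⟨fun P _ D hD lam hlam => hD.integral_lt hlam, ?_,
    fun P _ F hF => hF.ae_eventually_path_lt⟩
  rintro lam kap tau δ rfl rfl rfl rfl
  have hg := Apollonian.g_million.1
  have hg9 : 0 < 9 * Apollonian.g (10 ^ 6) := mul_pos (by norm_num) hg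
  refine ⟨Real.rpow_pos_of_pos hg9 _, Apollonian.three_exp_log_lt, Apollonian.exponent_lt, ?_⟩
  intro Ω _ P _ D hD
  have hE := (hD.integral_lt (lam := 10 ^ 6) (by
    have : Real.exp (-2) ≤ 1 := Real.exp_le_one_iff.2 (by norm_num)
    linarith)).2
  -- κ is chosen so that κ^λ = 1/(9g); the strict moment bound then makes the product less than 1.
  rw [← Real.rpow_mul hg9.le, div_mul_cancel₀ _ (by norm_num), Real.rpow_neg_one]
  calc _ < 9 * (9 * Apollonian.g (10 ^ 6))⁻¹ * Apollonian.g (10 ^ 6) :=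
        mul_lt_mul_of_pos_left hE (by positivity)
    _ = 1 := by field_simp
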